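/- Let $G=(V,E)$ be a finite graph with $n$ vertices and maximum degree $\Delta$; the vertices carry distinct IDs, and each vertex $v$ has a finite palette $\operatorname{Pal}(v)$ of at least $\Delta+1$ colors. For a constant $K>0$ put $\epsilon = 100^{-\sqrt{\ln\Delta}}/(100K)$, and assume $\epsilon^4\Delta\ge K\ln n$ (here $\ln 0:=0$). **Decomposition.** An edge $uv$ is a *friend edge* if $|N(u)\cap N(v)|\ge(1-\epsilon)\Delta$. A vertex is *dense* if at least $(1-\epsilon)\Delta$ of its incident edges are friend edges. The *almost-cliques* $C_1,\dots,C_k$ are the connected components of the graph formed by the dense vertices and the friend edges between them. They are computed once, from $G$. **Residual objects.** At any moment of the process below, the residual palette of $v$ is $\operatorname{Pal}(v)$ without the permanent colors of the neighbors of $v$, the residual almost-clique is the set of uncolored vertices of $C_j$ (again written $C_j$), and its leader $\ell_j$ is its member of smallest ID. **Initial coloring step.** Independently, each vertex $v$ takes a tentative color $A(v)$: with probability $1/100$ a uniformly random color of $\operatorname{Pal}(v)$, otherwise blank. A non-blank $A(v)$ becomes the permanent color of $v$ if no neighbor of $v$ has the same tentative color; otherwise $v$ stays uncolored. **Dense coloring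 steps.** Let $D_0=3\epsilon\Delta$, $Z_0=\Delta/2$ and, with $\delta_i=D_i/Z_i$, let $D_{i+1}=12D_i\sqrt{\delta_i}$, $Z_{i+1}=D_i/\sqrt{\delta_i}$; put $\gamma_i=1-2\sqrt{\delta_{i-1}}$. In step $i=1,\dots,\lceil\sqrt{\ln\Delta}\rceil$, each residual almost-clique $C_j$, independently of the others, draws a uniformly random permutation $\pi_j$ of its members, and for $k=1,\dots,\lceil|C_j|\gamma_i\rceil$ in turn the vertex $\pi_j(k)$ takes a tentative color, chosen uniformly at random from its residual palette minus the tentative colors already taken in $C_j$ in this step (blank if nothing is left). All other vertices are blank. Then each $v\in C_j$ with a non-blank tentative color makes it permanent, unless some uncolored dense neighbor $w\in C_{j'}$ of $v$ with $\operatorname{ID}(\ell_{j'})<\operatorname{ID}(\ell_j)$ has the same tentative color; in that case $v$ stays uncolored. **Theorem.** For every $K'>0$ there is $K_0>0$ such that for every $K\ge K_0$ there are constants $a,b>0$, depending only on $K'$ and $K$, such that for all $G$, palettes and IDs as above, with probability at least $1-n^{-K'}$, after the $\lceil\sqrt{\ln\Delta}\rceil$ dense coloring steps every dense vertex is adjacent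 to at most $$a\,\ln n\cdot 2^{\,b\sqrt{\ln\Delta}}\;=\;O(\log n)\cdot 2^{O(\sqrt{\log\Delta})}$$ other dense vertices that are uncolored. -/

import Mathlib

namespace DenseColoring

universe u v w

/-! ### Two discrete random experiments -/

theorem tsum_prod_eq_one {ι : Type u} {β : Type w} [Fintype ι] (p : ι → PMF β) :
    ∑' f : ι → β, ∏ i, p i (f i) = 1 := by
  classical
  refine Fintype.induction_empty_option
    (P := fun ι inst => ∀ p : ι → PMF β, ∑' f : ι → β, ∏ i, p i (f i) = 1)
    ?_ ?_ ?_ ι p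
  · intro α γ _ e ih p
    let _ := Fintype.ofEquiv γ e.symm
    rw [← ih (fun a => p (e a)), ← (Equiv.arrowCongr e (Equiv.refl β)).tsum_eq]
    refine tsum_congr fun f => ?_
    rw [← e.prod_comp]
    simp [Equiv.arrowCongr]
  · simp
  · intro α _ ih p
    rw [← (Equiv.piOptionEquivProd (β := fun _ : Option α => β)).symm.tsum_eq,
      ENNReal.tsum_prod']
    simp [Equiv.piOptionEquivProd, Fintype.prod_option, ENNReal.tsum_mul_left,
      ih (fun a => p (some a)), PMF.tsum_coe]

/-- The joint law of independent random variables `X i ∼ p i`, `i : ι`. -/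
noncomputable def independent {ι : Type u} {β : Type w} [Fintype ι] (p : ι → PMF β) :
    PMF (ι → β) :=
  ⟨fun f => ∏ i, p i (f i), by
    rw [← tsum_prod_eq_one p]; exact ENNReal.summable.hasSum⟩

/-- A uniformly random element of `s`. If there is nothing to choose from, the outcome is the
blank color `none`. -/
noncomputable def chooseUniform {C : Type v} (s : Finset C) : PMF (Option C) :=
  open Classical in
  if h : s.Nonempty then (PMF.uniformOfFinset s h).map some else PMF.pure none

/-! ### The decomposition into sparse vertices and almost-cliques -/

section Decomposition

variable {V : Type u} [Fintype V] (G : SimpleGraph V)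

open scoped Classical in
/-- The maximum degree `Δ` of `G`. -/
noncomputable def maxDeg : ℕ := G.maxDegree

/-- `uv` is a friend edge: an edge whose endpoints share at least `(1 - ε) Δ` neighbors. -/
def IsFriend (ε : ℝ) (x y : V) : Prop :=
  G.Adj x y ∧ (1 - ε) * (maxDeg G : ℝ) ≤ ((G.neighborSet x ∩ G.neighborSet y).ncard : ℝ)

/-- `x` is dense: it has at least `(1 - ε) Δ` friends. -/
def IsDense (ε : ℝ) (x : V) : Prop :=
  (1 - ε) * (maxDeg G : ℝ) ≤ ({y | IsFriend G ε x y}.ncard : ℝ)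

/-- The graph formed by the friend edges between dense vertices. The almost-cliques are its
connected components on the dense vertices; a sparse vertex is isolated in it and belongs to no
almost-clique. -/
def friendGraph (ε : ℝ) : SimpleGraph V where
  Adj x y := IsDense G ε x ∧ IsDense G ε y ∧ IsFriend G ε x y
  symm := ⟨fun _ _ h => ⟨h.2.1, h.1, h.2.2.1.symm, by
    rw [Set.inter_comm]; exact h.2.2.2⟩⟩
  loopless := ⟨fun _ h => G.loopless.irrefl _ h.2.2.1⟩

variable {C : Type v}

open scoped Classical in
/-- The almost-clique with index `j` at a moment when the partial coloring is `χ`: its uncolored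
members. (For the index of a sparse vertex this is the empty set.) -/
noncomputable def almostClique (ε : ℝ) (χ : V → Option C)
    (j : (friendGraph G ε).ConnectedComponent) : Finset V :=
  Finset.univ.filter fun x =>
    IsDense G ε x ∧ χ x = none ∧ (friendGraph G ε).connectedComponentMk x = j

/-- The ID of the leader of an almost-clique, which is its uncolored member of smallest ID. -/
noncomputable def leaderID (ε : ℝ) (ID : V → ℕ) (χ : V → Option C)
    (j : (friendGraph G ε).ConnectedComponent) : ℕ :=
  sInf (ID '' (almostClique G ε χ j : Set V))

open scoped Classical in
/-- The uncolored dense neighbors of `x` under the partial coloring `χ`. -/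
noncomputable def uncoloredDenseNeighbors (ε : ℝ) (χ : V → Option C) (x : V) : Finset V :=
  Finset.univ.filter fun y => G.Adj x y ∧ IsDense G ε y ∧ χ y = none

end Decomposition

/-! ### The parameters -/

/-- The density parameter `ε = 100 ^ (-√(ln Δ)) / (100 K)`. -/
noncomputable def epsilon (K : ℝ) (Δ : ℕ) : ℝ :=
  (100 : ℝ) ^ (-√(Real.log Δ)) / (100 * K)

/-- The pair `(D i, Z i)`: `D 0 = 3 ε Δ`, `Z 0 = Δ / 2`, and, with `δ i = D i / Z i`,
`D (i + 1) = 12 D i √(δ i)`, `Z (i + 1) = D i / √(δ i)`. -/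
noncomputable def boundDZ (K : ℝ) (Δ : ℕ) : ℕ → ℝ × ℝ
  | 0 => (3 * epsilon K Δ * Δ, (Δ : ℝ) / 2)
  | i + 1 =>
    let D := (boundDZ K Δ i).1
    let Z := (boundDZ K Δ i).2
    (12 * D * √(D / Z), D / √(D / Z))

/-- `gamma K Δ i = 1 - 2 √(D i / Z i)` is the parameter of the dense coloring step number
`i + 1`. -/
noncomputable def gamma (K : ℝ) (Δ : ℕ) (i : ℕ) : ℝ :=
  1 - 2 * √((boundDZ K Δ i).1 / (boundDZ K Δ i).2)

/-! ### The coloring process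

A partial coloring, and likewise a tentative coloring, is a function `V → Option C`; the value
`none` is the blank color. -/

section Algorithm

variable {V : Type u} [Fintype V] {C : Type v} (G : SimpleGraph V) (pal : V → Finset C)

open scoped Classical in
/-- The residual palette of `x`: its palette without the permanent colors of its neighbors. -/
noncomputable def residualPalette (χ : V → Option C) (x : V) : Finset C :=
  (pal x).filter fun c => ∀ y, G.Adj x y → χ y ≠ some c

open scoped Classical in
/-- In the initial coloring step a tentative color becomes permanent if no neighbor has chosen the
same one. -/
noncomputable def initialCommit (A : V → Option C) (x : V) : Option C :=
  if ∃ y, G.Adj x y ∧ A y = A x then none else A x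

/-- The initial coloring step: independently, each vertex tentatively takes a uniformly random
color of its palette with probability `1 / 100`, and the blank color with probability
`99 / 100`. -/
noncomputable def initialStep : PMF (V → Option C) :=
  (independent fun x : V => (PMF.uniformOfFintype (Fin 100)).bind fun k =>
    if k = 0 then chooseUniform (pal x) else PMF.pure none).map (initialCommit G)

open scoped Classical in
/-- Starting from the tentative coloring `A`, the vertices of a list choose, one after the other,
a uniformly random color of their palette `P` that has not been chosen before. -/
noncomputable def sequentialChoice (P : V → Finset C) :
    List V → (V → Option C) → PMF (V → Option C)
  | [], A => PMF.pure A
  | x :: l, A =>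
    (chooseUniform ((P x).filter fun c => ∀ y, A y ≠ some c)).bind fun a =>
      sequentialChoice P l (Function.update A x a)

/-- The tentative coloring of one set `S` of vertices: the vertices `π 1, …, π L` with
`L = ⌈|S| γ⌉`, in the order of a uniformly random permutation `π` of `S`, choose sequentially. All
other vertices are blank. -/
noncomputable def cliqueChoice (P : V → Finset C) (γ : ℝ) (S : Finset V) : PMF (V → Option C) :=
  open scoped Classical in
  haveI : Nonempty (Fin S.card ≃ S) := ⟨S.equivFin.symm⟩
  (PMF.uniformOfFintype (Fin S.card ≃ S)).bind fun π =>
    sequentialChoice P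
      ((List.ofFn fun k => (π k : V)).take ⌈(S.card : ℝ) * γ⌉₊) fun _ => none

open scoped Classical in
/-- At the end of a dense coloring step a vertex keeps its tentative color `A x`, unless a neighbor
in an almost-clique whose leader has smaller ID has chosen the same color. Vertices colored
earlier keep their color. -/
noncomputable def denseCommit (ε : ℝ) (ID : V → ℕ) (χ A : V → Option C) (x : V) : Option C :=
  if χ x ≠ none then χ x
  else if ∃ y, G.Adj x y ∧ IsDense G ε y ∧ χ y = none ∧ A y = A x ∧
      leaderID G ε ID χ ((friendGraph G ε).connectedComponentMk y) <
        leaderID G ε ID χ ((friendGraph G ε).connectedComponentMk x) then none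
  else A x

open scoped Classical in
/-- One dense coloring step with parameter `γ`, from the partial coloring `χ`: all almost-cliques
choose tentative colors independently of each other, and conflicts are resolved. -/
noncomputable def denseStep (ε : ℝ) (ID : V → ℕ) (γ : ℝ) (χ : V → Option C) :
    PMF (V → Option C) :=
  (independent fun j : (friendGraph G ε).ConnectedComponent =>
    cliqueChoice (residualPalette G pal χ) γ (almostClique G ε χ j)).map fun B =>
      denseCommit G ε ID χ fun x => B ((friendGraph G ε).connectedComponentMk x) x

/-- The law of the partial coloring after the initial coloring step and `i` dense coloring steps,
for the constant `K`. -/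
noncomputable def coloringAfter (ID : V → ℕ) (K : ℝ) : ℕ → PMF (V → Option C)
  | 0 => initialStep G pal
  | i + 1 => (coloringAfter ID K i).bind
      (denseStep G pal (epsilon K (maxDeg G)) ID (gamma K (maxDeg G) i))

end Algorithm

end DenseColoring

namespace DenseColoring

open scoped ENNReal Classical

universe u v w

/-! ### Expectations -/

/-! Write `s = √(D / Z)`, so `D = s² Z`. The engine is a joint moment bound for one dense step: any
set `T` of uncolored dense vertices stays uncolored with probability at most `(3s)^|T|`. A vertex
stays uncolored either because the permutation does not let it choose (`2s`, as `γ = 1 - 2s`), or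
because its tentative color is blank or in conflict. When it chooses, at least `s Z` colors are
free, so it is never blank, and at most `D` colors are in conflict: probability `D / (s Z) = s`.
These bounds multiply over `T`: along the sequential choices and the random order within a clique
(`expect_cliqueChoice_le`), and over the cliques in the order of their leader IDs, since a clique
only loses to cliques with smaller leaders (`expect_denseStep_le`). Joint moment bounds suffice for
a Chernoff tail (`expect_ind_lt_card_le`), so the bounds on external neighbors, anti-neighbors and
uncolored dense neighbors each shrink by the factor `12 s`, with failure probability `exp(-3 s D)`
per count.

The `s Z` free colors come from a count: with palettes of size at least `Δ + 1`, the residual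
palette exceeds the residual clique by at least the number of uncolored sparse neighbors minus the
number of anti-neighbors (`Invariant.palette_ge`). Either there are many sparse neighbors, which the
dense steps never color, or the clique has size at least `Z`, and the members that do not choose
provide the slack. `Invariant` records this; it holds at the start by the geometry of almost-cliques
and because the initial step colors few vertices.

The ratio `D / Z` grows only by a factor 12 per step, so by the choice of `ε` every step shrinks the
bounds by at least `exp(-√(ln Δ))`, and `⌈√(ln Δ)⌉` steps would bring `Δ` down to 1. Concentration
needs `s D ≥ c = (K' + 5) ln n`. At the first step where this fails, `D < c / s`, and the bound `D /
(3ε)` on uncolored dense neighbors is already of order `c / ε²`, as required. Later steps cannot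
increase the count. -/

/-- The expectation of a nonnegative function under a discrete law. -/
noncomputable def expect {α : Type u} (p : PMF α) (F : α → ℝ≥0∞) : ℝ≥0∞ := ∑' x, p x * F x

/-- The indicator of a proposition. -/
noncomputable def ind (P : Prop) : ℝ≥0∞ := if P then 1 else 0

theorem ind_of_true {P : Prop} (h : P) : ind P = 1 := if_pos h

theorem ind_of_false {P : Prop} (h : ¬P) : ind P = 0 := if_neg h

theorem ind_le_one (P : Prop) : ind P ≤ 1 := by unfold ind; split_ifs <;> simp

theorem ind_mono {P Q : Prop} (h : P → Q) : ind P ≤ ind Q := by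
  by_cases hP : P
  · rw [ind_of_true hP, ind_of_true (h hP)]
  · rw [ind_of_false hP]; exact zero_le

theorem ind_or_le (P Q : Prop) : ind (P ∨ Q) ≤ ind P + ind Q := by
  by_cases hP : P
  · rw [ind_of_true hP]; exact (ind_le_one _).trans le_self_add
  · simp [hP]

section Expect

variable {α : Type u} {β : Type v} {p : PMF α} {F F' : α → ℝ≥0∞}

theorem expect_pure (a : α) (F : α → ℝ≥0∞) : expect (PMF.pure a) F = F a := by
  unfold expect
  rw [tsum_eq_single a]
  · simp
  · intro b hb; simp [hb]

theorem expect_bind (p : PMF α) (f : α → PMF β) (F : β → ℝ≥0∞) :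
    expect (p.bind f) F = expect p fun a => expect (f a) F := by
  simp only [expect, PMF.bind_apply, ← ENNReal.tsum_mul_left, ← ENNReal.tsum_mul_right]
  rw [ENNReal.tsum_comm]
  simp only [mul_assoc]

theorem expect_map (p : PMF α) (f : α → β) (F : β → ℝ≥0∞) :
    expect (p.map f) F = expect p fun a => F (f a) := by
  rw [← PMF.bind_pure_comp, expect_bind]
  simp [expect_pure]

theorem expect_mono (h : ∀ x ∈ p.support, F x ≤ F' x) : expect p F ≤ expect p F' := by
  refine ENNReal.tsum_le_tsum fun x => ?_
  by_cases hx : x ∈ p.support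
  · gcongr; exact h x hx
  · rw [PMF.mem_support_iff, not_not] at hx; simp [hx]

theorem expect_const (c : ℝ≥0∞) : expect p (fun _ => c) = c := by
  simp [expect, ENNReal.tsum_mul_right, p.tsum_coe]

theorem expect_le_of_forall {c : ℝ≥0∞} (h : ∀ x ∈ p.support, F x ≤ c) : expect p F ≤ c :=
  (expect_mono h).trans_eq (expect_const c)

theorem expect_const_mul (c : ℝ≥0∞) : expect p (fun x => c * F x) = c * expect p F := by
  simp only [expect, ← ENNReal.tsum_mul_left]
  exact tsum_congr fun x => by ring

theorem expect_add : expect p (fun x => F x + F' x) = expect p F + expect p F' := by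
  simp only [expect, mul_add, ENNReal.tsum_add]

theorem expect_sum {ι : Type w} (s : Finset ι) (F : ι → α → ℝ≥0∞) :
    expect p (fun x => ∑ i ∈ s, F i x) = ∑ i ∈ s, expect p (F i) := by
  induction s using Finset.induction_on with
  | empty => simp [expect]
  | insert i s hi ih => simp only [Finset.sum_insert hi, expect_add, ih]

theorem expect_uniformOfFintype [Fintype α] [Nonempty α] (F : α → ℝ≥0∞) :
    expect (PMF.uniformOfFintype α) F = (∑ x, F x) / Fintype.card α := by
  rw [expect, tsum_fintype, ENNReal.div_eq_inv_mul, Finset.mul_sum]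
  simp

theorem toOuterMeasure_eq_expect (s : Set α) :
    p.toOuterMeasure s = expect p fun x => ind (x ∈ s) := by
  rw [PMF.toOuterMeasure_apply]
  refine tsum_congr fun x => ?_
  by_cases hx : x ∈ s
  · simp [ind, hx]
  · simp [ind, hx]

theorem expect_ind_add_expect_ind_not (P : α → Prop) :
    expect p (fun x => ind (P x)) + expect p (fun x => ind (¬P x)) = 1 := by
  rw [← expect_add, ← expect_const (p := p) 1]
  congr 1
  funext x
  by_cases hx : P x <;> simp [ind, hx]

theorem expect_ind_exists_le {ι : Type w} [Fintype ι] (P : ι → α → Prop) :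
    expect p (fun x => ind (∃ i, P i x)) ≤ ∑ i, expect p fun x => ind (P i x) := by
  rw [← expect_sum]
  refine expect_mono fun x _ => ?_
  by_cases h : ∃ i, P i x
  · obtain ⟨i, hi⟩ := h
    rw [ind_of_true ⟨i, hi⟩, ← ind_of_true hi]
    exact Finset.single_le_sum (f := fun i => ind (P i x)) (fun _ _ => zero_le) (Finset.mem_univ i)
  · rw [ind_of_false h]; exact zero_le

end Expect

/-! ### Independent families -/

section Independent

variable {ι : Type u} {β : Type w} [Fintype ι] (p : ι → PMF β)

theorem independent_apply (f : ι → β) : independent p f = ∏ i, p i (f i) := rfl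

theorem mem_support_of_independent {f : ι → β} (hf : f ∈ (independent p).support) (i : ι) :
    f i ∈ (p i).support := by
  rw [PMF.mem_support_iff, independent_apply] at hf
  rw [PMF.mem_support_iff]
  exact Finset.prod_ne_zero_iff.1 hf i (Finset.mem_univ i)

/-- Exchanging the coordinate `j` with an independent fresh copy is a weight-preserving involution
on pairs. This allows one coordinate to be averaged out with the others held fixed. -/
theorem expect_independent_resample (j : ι) (F : (ι → β) → ℝ≥0∞) :
    expect (independent p) (fun f => expect (p j) fun b => F (Function.update f j b)) =
      expect (independent p) F := by
  let e : (ι → β) × β ≃ (ι → β) × β :=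
    { toFun := fun z => (Function.update z.1 j z.2, z.1 j)
      invFun := fun z => (Function.update z.1 j z.2, z.1 j)
      left_inv := fun z => by simp
      right_inv := fun z => by simp }
  have hw : ∀ (f : ι → β) (b : β), independent p (Function.update f j b) * p j (f j) =
      independent p f * p j b := by
    intro f b
    rw [independent_apply, independent_apply, ← Finset.mul_prod_erase _ _ (Finset.mem_univ j),
      ← Finset.mul_prod_erase Finset.univ (fun i => p i (f i)) (Finset.mem_univ j),
      Function.update_self]
    rw [Finset.prod_congr rfl (g := fun i => p i (f i)) fun i hi => by
      rw [Function.update_of_ne (Finset.ne_of_mem_erase hi)]]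
    ring
  calc
    _ = ∑' z : (ι → β) × β, independent p z.1 * p j z.2 * F (Function.update z.1 j z.2) := by
      simp only [expect, ← ENNReal.tsum_mul_left, ENNReal.tsum_prod', mul_assoc]
    _ = ∑' z : (ι → β) × β, independent p z.1 * p j z.2 * F z.1 := by
      rw [← e.tsum_eq (fun z => independent p z.1 * p j z.2 * F z.1)]
      exact tsum_congr fun z => by simp only [e, Equiv.coe_fn_mk, hw]
    _ = _ := by
      simp only [expect, ENNReal.tsum_prod', mul_right_comm _ (p j _), ENNReal.tsum_mul_left,
        PMF.tsum_coe, mul_one]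

/-- If `F j` depends on the coordinate `j` and on coordinates of smaller rank only, and has
expectation at most `q j` however the other coordinates are fixed, then the product of the `F j`
has expectation at most the product of the `q j`. -/
theorem expect_independent_prod_le (rank : ι → ℕ) (F : ι → (ι → β) → ℝ≥0∞) (q : ι → ℝ≥0∞)
    (hdep : ∀ j k, k ≠ j → ¬rank k < rank j → ∀ f b, F j (Function.update f k b) = F j f)
    (hq : ∀ j f, expect (p j) (fun b => F j (Function.update f j b)) ≤ q j) (s : Finset ι) :
    expect (independent p) (fun f => ∏ j ∈ s, F j f) ≤ ∏ j ∈ s, q j := by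
  induction hn : s.card generalizing s with
  | zero => rw [Finset.card_eq_zero.1 hn]; simp [expect_const]
  | succ n ih =>
    have hs : s.Nonempty := Finset.card_pos.1 (by omega)
    -- No other factor indexed by `s` sees the coordinate of largest rank, so resampling it replaces
    -- `F j` by its conditional expectation, which is at most `q j`.
    obtain ⟨j, hj, hmax⟩ := s.exists_max_image rank hs
    rw [← expect_independent_resample p j, ← Finset.mul_prod_erase s q hj]
    calc
      _ = expect (independent p) (fun f => (∏ k ∈ s.erase j, F k f) *
            expect (p j) fun b => F j (Function.update f j b)) := by
        congr 1
        funext f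
        rw [← expect_const_mul]
        congr 1
        funext b
        rw [← Finset.mul_prod_erase s _ hj, mul_comm]
        congr 1
        refine Finset.prod_congr rfl fun k hk => ?_
        exact hdep k j (Finset.ne_of_mem_erase hk).symm
          (not_lt.2 (hmax k (Finset.mem_of_mem_erase hk))) f b
      _ ≤ expect (independent p) (fun f => q j * ∏ k ∈ s.erase j, F k f) := by
        refine expect_mono fun f _ => ?_
        rw [mul_comm]
        gcongr
        exact hq j f
      _ ≤ _ := by
        rw [expect_const_mul]
        gcongr
        exact ih _ (by rw [Finset.card_erase_of_mem hj]; omega)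

end Independent

/-! ### Random bijections -/

/-- A uniformly random bijection maps a given set `U` into `W` with probability at most
`(|W| / m) ^ |U|`. -/
theorem card_equiv_mapsTo_mul_le {α : Type u} {β : Type v} [Fintype α] [Fintype β] (W : Finset β)
    (U : Finset α) :
    (Finset.univ.filter fun e : α ≃ β => ∀ x ∈ U, e x ∈ W).card * Fintype.card α ^ U.card ≤
      Fintype.card (α ≃ β) * W.card ^ U.card := by
  induction U using Finset.induction_on with
  | empty => simp
  | insert x U hx ih =>
    rw [Finset.card_insert_of_notMem hx, pow_succ, pow_succ]
    set N : Finset (α ≃ β) := Finset.univ.filter fun e => ∀ y ∈ U, e y ∈ W with hN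
    set N' : α → Finset (α ≃ β) := fun x => N.filter fun e => e x ∈ W with hN'
    have hxN : (Finset.univ.filter fun e : α ≃ β => ∀ y ∈ insert x U, e y ∈ W) = N' x := by
      ext e; simp [hN, hN', and_comm]
    rw [hxN]
    by_cases hemp : Nonempty (α ≃ β)
    swap
    · rw [not_nonempty_iff] at hemp
      simp [Finset.eq_empty_of_isEmpty]
    obtain ⟨e₀⟩ := hemp
    -- Precomposing with the transposition of `x` and `y` fixes `U` pointwise, so all points outside
    -- `U` are equally likely to land in `W`.
    have hsymm : ∀ y, y ∉ U → (N' y).card = (N' x).card := by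
      intro y hy
      refine Finset.card_bij' (fun e _ => (Equiv.swap x y).trans e)
        (fun e _ => (Equiv.swap x y).trans e) ?_ ?_ ?_ ?_
      · intro e he
        simp only [hN', hN, Finset.mem_filter, Finset.mem_univ, true_and, Equiv.trans_apply,
          Equiv.swap_apply_left] at he ⊢
        refine ⟨fun z hz => ?_, he.2⟩
        rw [Equiv.swap_apply_of_ne_of_ne (ne_of_mem_of_not_mem hz hx)
          (ne_of_mem_of_not_mem hz hy)]
        exact he.1 z hz
      · intro e he
        simp only [hN', hN, Finset.mem_filter, Finset.mem_univ, true_and, Equiv.trans_apply,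
          Equiv.swap_apply_right] at he ⊢
        refine ⟨fun z hz => ?_, he.2⟩
        rw [Equiv.swap_apply_of_ne_of_ne (ne_of_mem_of_not_mem hz hx)
          (ne_of_mem_of_not_mem hz hy)]
        exact he.1 z hz
      · intro e _; ext; simp
      · intro e _; ext; simp
    -- Double count of the pairs `(e, y)` with `e ∈ N` and `e y ∈ W`: the points of `U` always land
    -- in `W`.
    have hsum : (Fintype.card α - U.card) * (N' x).card + U.card * N.card = W.card * N.card := by
      have h1 : ∑ y, (N' y).card = W.card * N.card := by
        have h2 : ∀ y, (N' y).card = ∑ e ∈ N, if e y ∈ W then 1 else 0 := fun y => by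
          rw [Finset.card_filter]
        simp only [h2]
        rw [Finset.sum_comm]
        rw [Finset.sum_congr rfl (g := fun _ => W.card), Finset.sum_const, smul_eq_mul, mul_comm]
        intro e _
        rw [← Finset.card_filter]
        refine Finset.card_bij (fun y _ => e y) (fun y hy => (Finset.mem_filter.1 hy).2)
          (fun _ _ _ _ h => e.injective h) fun z hz => ⟨e.symm z, ?_, by simp⟩
        simpa using hz
      rw [← h1, ← Finset.sum_add_sum_compl U, add_comm]
      congr 1
      · rw [Finset.sum_congr rfl (g := fun _ => N.card), Finset.sum_const, smul_eq_mul]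
        intro y hy
        congr 1
        refine Finset.filter_true_of_mem fun e he => ?_
        exact (Finset.mem_filter.1 he).2 y hy
      · rw [Finset.sum_congr rfl (g := fun _ => (N' x).card), Finset.sum_const, smul_eq_mul,
          Finset.card_compl]
        intro y hy
        exact hsymm y (Finset.mem_compl.1 hy)
    have hW : W.card ≤ Fintype.card α := by
      rw [Fintype.card_congr e₀]; exact Finset.card_le_univ W
    have hU : U.card ≤ Fintype.card α := Finset.card_le_univ U
    have hle : (N' x).card ≤ N.card := Finset.card_filter_le _ _
    have key : (N' x).card * Fintype.card α ≤ W.card * N.card := by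
      obtain ⟨r, hr⟩ := Nat.exists_eq_add_of_le hU
      rw [← hsum, hr]
      rw [Nat.add_sub_cancel_left, mul_comm, add_mul, add_comm]
      gcongr
    calc (N' x).card * (Fintype.card α ^ U.card * Fintype.card α)
        = ((N' x).card * Fintype.card α) * Fintype.card α ^ U.card := by ring
      _ ≤ (W.card * N.card) * Fintype.card α ^ U.card := by gcongr
      _ = (N.card * Fintype.card α ^ U.card) * W.card := by ring
      _ ≤ (Fintype.card (α ≃ β) * W.card ^ U.card) * W.card := by gcongr
      _ = _ := by ring

/-! ### A tail bound -/

/-- An upper tail bound for a sum of indicators all of whose joint moments are at most those of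
independent indicators of probability `q`. -/
theorem expect_ind_lt_card_le {α : Type u} {ι : Type v} (p : PMF α) (S : Finset ι)
    (bad : α → ι → Prop) {q M : ℝ} (hq : 0 ≤ q) (hM : (S.card : ℝ) ≤ M)
    (h : ∀ T ⊆ S, expect p (fun a => ∏ x ∈ T, ind (bad a x)) ≤ ENNReal.ofReal q ^ T.card) :
    expect p (fun a => ind (4 * q * M < ((S.filter (bad a)).card : ℝ))) ≤
      ENNReal.ofReal (Real.exp (-(q * M))) := by
  have hM0 : 0 ≤ M := le_trans (by positivity) hM
  -- Markov's inequality for `4 ^ X`, where `X` counts the bad elements: the product equals `4 ^ X`,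
  -- which is at least `exp (4 q M)` on the event because `e ≤ 4`.
  have h1 : ∀ a, ind (4 * q * M < ((S.filter (bad a)).card : ℝ)) ≤
      ENNReal.ofReal (Real.exp (-(4 * q * M))) * ∏ x ∈ S, (3 * ind (bad a x) + 1) := by
    intro a
    by_cases hlt : 4 * q * M < ((S.filter (bad a)).card : ℝ)
    swap
    · rw [ind_of_false hlt]; exact zero_le
    rw [ind_of_true hlt]
    have h2 : ∏ x ∈ S, (3 * ind (bad a x) + 1) = ENNReal.ofReal (4 ^ (S.filter (bad a)).card) := by
      rw [ENNReal.ofReal_pow (by norm_num), ← Finset.prod_const, Finset.prod_filter]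
      refine Finset.prod_congr rfl fun x _ => ?_
      by_cases hb : bad a x
      · simp only [ind, hb, if_true]; norm_num
      · simp [ind, hb]
    rw [h2, ← ENNReal.ofReal_mul (Real.exp_nonneg _), ← ENNReal.ofReal_one]
    apply ENNReal.ofReal_le_ofReal
    have h3 : Real.exp (4 * q * M) ≤ 4 ^ (S.filter (bad a)).card := by
      calc Real.exp (4 * q * M) ≤ Real.exp ((S.filter (bad a)).card : ℝ) :=
            Real.exp_le_exp.2 hlt.le
        _ = Real.exp 1 ^ (S.filter (bad a)).card := by rw [← Real.exp_nat_mul, mul_one]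
        _ ≤ _ := by gcongr; linarith [Real.exp_one_lt_d9]
    calc (1 : ℝ) = Real.exp (-(4 * q * M)) * Real.exp (4 * q * M) := by
          rw [← Real.exp_add]; simp
      _ ≤ _ := by gcongr
  -- Expanding over subsets expresses the expectation of `4 ^ X` through the joint moments, and the
  -- binomial theorem reassembles their bounds.
  have h4 : expect p (fun a => ∏ x ∈ S, (3 * ind (bad a x) + 1)) ≤
      ENNReal.ofReal (Real.exp (3 * q * M)) := by
    calc _ = ∑ T ∈ S.powerset, 3 ^ T.card * expect p (fun a => ∏ x ∈ T, ind (bad a x)) := by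
          rw [← Finset.sum_congr rfl fun T _ => expect_const_mul _, ← expect_sum]
          congr 1
          funext a
          rw [Finset.prod_add]
          refine Finset.sum_congr rfl fun T _ => ?_
          rw [Finset.prod_mul_distrib]
          simp
      _ ≤ ∑ T ∈ S.powerset, 3 ^ T.card * ENNReal.ofReal q ^ T.card := by
          refine Finset.sum_le_sum fun T hT => ?_
          gcongr
          exact h T (Finset.mem_powerset.1 hT)
      _ = (3 * ENNReal.ofReal q + 1) ^ S.card := by
          rw [← Finset.sum_pow_mul_eq_add_pow]
          simp [mul_pow]
      _ = ENNReal.ofReal ((3 * q + 1) ^ S.card) := by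
          rw [ENNReal.ofReal_pow (by positivity), ENNReal.ofReal_add (by positivity) (by norm_num),
            ENNReal.ofReal_mul (by norm_num)]
          simp
      _ ≤ _ := by
          apply ENNReal.ofReal_le_ofReal
          calc (3 * q + 1) ^ S.card ≤ Real.exp (3 * q) ^ S.card := by
                gcongr; exact Real.add_one_le_exp _
            _ = Real.exp (S.card * (3 * q)) := by rw [← Real.exp_nat_mul]
            _ ≤ _ := by
                apply Real.exp_le_exp.2
                nlinarith
  calc _ ≤ expect p (fun a => ENNReal.ofReal (Real.exp (-(4 * q * M))) *
        ∏ x ∈ S, (3 * ind (bad a x) + 1)) := expect_mono fun a _ => h1 a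
    _ ≤ ENNReal.ofReal (Real.exp (-(4 * q * M))) * ENNReal.ofReal (Real.exp (3 * q * M)) := by
        rw [expect_const_mul]; gcongr
    _ = _ := by
        rw [← ENNReal.ofReal_mul (Real.exp_nonneg _), ← Real.exp_add]
        congr 2; ring

/-! ### Sequential choices -/

section Choice

variable {V : Type u} {C : Type v}

theorem expect_chooseUniform_le {s B : Finset C} {D R : ℝ} (hR : 0 < R) (hs : R ≤ s.card)
    (hB : (B.card : ℝ) ≤ D) :
    expect (chooseUniform s) (fun a => ind (a = none ∨ ∃ c ∈ B, a = some c)) ≤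
      ENNReal.ofReal (D / R) := by
  have hcard : (0 : ℝ) < s.card := hR.trans_le hs
  have hne : s.Nonempty := Finset.card_pos.1 (by exact_mod_cast hcard)
  rw [chooseUniform, dif_pos hne, expect_map]
  have h1 : ∀ c, ind ((some c : Option C) = none ∨ ∃ d ∈ B, some c = some d) = ind (c ∈ B) := by
    intro c; congr 1; simp
  simp only [h1]
  calc _ = ∑' c, PMF.uniformOfFinset s hne c * ind (c ∈ B) := rfl
    _ ≤ ∑' c, (s.card : ℝ≥0∞)⁻¹ * ind (c ∈ B) := by
        refine ENNReal.tsum_le_tsum fun c => ?_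
        gcongr
        rw [PMF.uniformOfFinset_apply]
        split_ifs <;> simp
    _ = (s.card : ℝ≥0∞)⁻¹ * B.card := by
        rw [ENNReal.tsum_mul_left, tsum_eq_sum (s := B)]
        · simp +contextual [ind]
        · intro c hc; exact ind_of_false hc
    _ = ENNReal.ofReal (B.card / s.card) := by
        rw [div_eq_inv_mul, ENNReal.ofReal_mul (by positivity), ENNReal.ofReal_inv_of_pos hcard]
        simp
    _ ≤ _ := by
        apply ENNReal.ofReal_le_ofReal
        have : (0 : ℝ) ≤ B.card := by positivity
        gcongr
        linarith

/-- The list of the vertices that choose a color when the random permutation is `π`. -/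
def choosers {S : Finset V} (π : Fin S.card ≃ S) (L : ℕ) : List V :=
  (List.ofFn fun k => (π k : V)).take L

theorem mem_choosers {S : Finset V} (π : Fin S.card ≃ S) (L : ℕ) (x : S) :
    (x : V) ∈ choosers π L ↔ (π.symm x : ℕ) < L := by
  rw [choosers, List.mem_take_iff_getElem]
  constructor
  · rintro ⟨i, hi, h⟩
    rw [List.getElem_ofFn, Subtype.coe_inj] at h
    rw [← h, Equiv.symm_apply_apply]
    exact (lt_min_iff.1 hi).1
  · intro h
    refine ⟨π.symm x, lt_min h (by simp), ?_⟩
    rw [List.getElem_ofFn]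
    simp

theorem mem_of_mem_choosers {S : Finset V} {π : Fin S.card ≃ S} {L : ℕ} {x : V}
    (h : x ∈ choosers π L) : x ∈ S := by
  have := List.mem_of_mem_take h
  rw [List.mem_ofFn] at this
  obtain ⟨k, rfl⟩ := this
  exact (π k).2

theorem nodup_choosers {S : Finset V} (π : Fin S.card ≃ S) (L : ℕ) : (choosers π L).Nodup :=
  (List.nodup_ofFn.2 (Subtype.val_injective.comp π.injective)).sublist (List.take_sublist _ _)

theorem length_choosers {S : Finset V} (π : Fin S.card ≃ S) (L : ℕ) :
    (choosers π L).length = min L S.card := by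
  simp [choosers]

variable [Fintype V]

theorem eq_of_mem_support_sequentialChoice {P : V → Finset C} {l : List V} {A A' : V → Option C}
    (h : A' ∈ (sequentialChoice P l A).support) {y : V} (hy : y ∉ l) : A' y = A y := by
  induction l generalizing A with
  | nil => rw [sequentialChoice, PMF.mem_support_pure_iff] at h; rw [h]
  | cons x l ih =>
    rw [sequentialChoice, PMF.mem_support_bind_iff] at h
    obtain ⟨a, -, ha⟩ := h
    rw [ih ha (fun h => hy (List.mem_cons_of_mem _ h)),
      Function.update_of_ne (fun h => hy (by rw [h]; exact List.mem_cons_self))]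

/-- The vertices with a color. -/
noncomputable def colored (A : V → Option C) : Finset V := Finset.univ.filter fun x => A x ≠ none

theorem card_filter_unused_ge (P : Finset C) (A : V → Option C) :
    P.card ≤ (P.filter fun c => ∀ y, A y ≠ some c).card + (colored A).card := by
  rw [← Finset.card_filter_add_card_filter_not (s := P) fun c => ∀ y, A y ≠ some c]
  gcongr
  rw [← Finset.card_map (s := P.filter _) ⟨some, Option.some_injective C⟩]
  refine (Finset.card_le_card fun a ha => ?_).trans (Finset.card_image_le (f := A))
  simp only [Finset.mem_map, Finset.mem_filter, not_forall, not_not] at ha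
  obtain ⟨c, ⟨-, y, hy⟩, rfl⟩ := ha
  exact Finset.mem_image.2 ⟨y, by simp [colored, hy], hy⟩

/-- Each choice is bounded conditionally on the earlier ones. The number of used colors plus the
length of the remaining list never grows, so `hP` passes to the tail. It leaves every vertex of `T`
at least `R` unused colors at its turn; the `+ 1` accounts for the vertex itself, which is counted
in the list. -/
theorem expect_sequentialChoice_le {P B : V → Finset C} {T : Finset V} {D R : ℝ} (hR : 0 < R)
    {l : List V} (hl : l.Nodup) {A : V → Option C}
    (hP : ∀ x ∈ l, x ∈ T → (colored A).card + l.length + R ≤ (P x).card + 1)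
    (hB : ∀ x ∈ l, x ∈ T → ((B x).card : ℝ) ≤ D) :
    expect (sequentialChoice P l A) (fun A' =>
        (l.map fun x => if x ∈ T then ind (A' x = none ∨ ∃ c ∈ B x, A' x = some c) else 1).prod) ≤
      (l.map fun x => if x ∈ T then ENNReal.ofReal (D / R) else 1).prod := by
  induction l generalizing A with
  | nil => simp [expect_const]
  | cons x l ih =>
    rw [List.nodup_cons] at hl
    rw [sequentialChoice, expect_bind]
    simp only [List.map_cons, List.prod_cons]
    calc _ ≤ expect (chooseUniform ((P x).filter fun c => ∀ y, A y ≠ some c)) (fun a =>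
          (if x ∈ T then ind (a = none ∨ ∃ c ∈ B x, a = some c) else 1) *
            (l.map fun x => if x ∈ T then ENNReal.ofReal (D / R) else 1).prod) := by
          refine expect_mono fun a _ => ?_
          calc _ = expect (sequentialChoice P l (Function.update A x a)) (fun A' =>
                (if x ∈ T then ind (a = none ∨ ∃ c ∈ B x, a = some c) else 1) * (l.map fun x =>
                  if x ∈ T then ind (A' x = none ∨ ∃ c ∈ B x, A' x = some c) else 1).prod) := by
                refine le_antisymm (expect_mono fun A' hA' => ?_) (expect_mono fun A' hA' => ?_) <;>
                  rw [eq_of_mem_support_sequentialChoice hA' hl.1, Function.update_self]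
            _ ≤ _ := by
                rw [expect_const_mul]
                gcongr
                refine ih hl.2 (fun y hy hyT => ?_)
                  (fun y hy hyT => hB y (List.mem_cons_of_mem _ hy) hyT)
                have h1 := hP y (List.mem_cons_of_mem _ hy) hyT
                have h2 : (colored (Function.update A x a)).card ≤ (colored A).card + 1 := by
                  rw [← Finset.card_singleton x]
                  refine (Finset.card_le_card fun z hz => ?_).trans (Finset.card_union_le _ _)
                  by_cases hzx : z = x
                  · simp [hzx]
                  · simpa [colored, hzx] using hz
                have h3 : ((colored (Function.update A x a)).card : ℝ) ≤ (colored A).card + 1 := by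
                  exact_mod_cast h2
                simp only [List.length_cons] at h1
                push_cast at h1
                linarith
      _ = (l.map fun x => if x ∈ T then ENNReal.ofReal (D / R) else 1).prod *
          expect (chooseUniform ((P x).filter fun c => ∀ y, A y ≠ some c)) (fun a =>
          (if x ∈ T then ind (a = none ∨ ∃ c ∈ B x, a = some c) else 1)) := by
          rw [← expect_const_mul]; simp only [mul_comm]
      _ ≤ _ := by
          rw [mul_comm]
          gcongr
          split_ifs with hx
          · refine expect_chooseUniform_le hR ?_ (hB x List.mem_cons_self hx)
            have h1 := hP x List.mem_cons_self hx
            have h2 : ((P x).card : ℝ) ≤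
                ((P x).filter fun c => ∀ y, A y ≠ some c).card + (colored A).card := by
              exact_mod_cast card_filter_unused_ge (P x) A
            simp only [List.length_cons] at h1
            push_cast at h1
            have h3 : (0 : ℝ) ≤ l.length := by positivity
            linarith
          · rw [expect_const]

/-! ### One almost-clique -/

theorem cliqueChoice_eq (P : V → Finset C) (γ : ℝ) (S : Finset V) :
    haveI : Nonempty (Fin S.card ≃ S) := ⟨S.equivFin.symm⟩
    cliqueChoice P γ S = (PMF.uniformOfFintype (Fin S.card ≃ S)).bind fun π =>
      sequentialChoice P (choosers π ⌈(S.card : ℝ) * γ⌉₊) fun _ => none := by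
  unfold cliqueChoice choosers
  congr!

theorem mem_support_cliqueChoice {P : V → Finset C} {γ : ℝ} {S : Finset V} {A : V → Option C}
    (h : A ∈ (cliqueChoice P γ S).support) :
    ∃ π : Fin S.card ≃ S, ∀ x ∉ choosers π ⌈(S.card : ℝ) * γ⌉₊, A x = none := by
  rw [cliqueChoice_eq, PMF.mem_support_bind_iff] at h
  obtain ⟨π, -, hπ⟩ := h
  exact ⟨π, fun x hx => eq_of_mem_support_sequentialChoice hπ hx⟩

/-- The probability that none of the vertices of `U` is among the first `L` in a uniformly random
order of `S`. -/
theorem sum_ind_not_chooser_le {S : Finset V} (L : ℕ) {ρ : ℝ}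
    (hρ : ((S.card - L : ℕ) : ℝ) ≤ ρ * S.card) (U : Finset V) (hU : U ⊆ S) :
    (∑ π : Fin S.card ≃ S, ∏ x ∈ U, ind (x ∉ choosers π L)) / Fintype.card (Fin S.card ≃ S) ≤
      ENNReal.ofReal ρ ^ U.card := by
  set m := S.card with hm
  rcases Nat.eq_zero_or_pos m with h0 | hpos
  · have : U = ∅ := by
      rw [← Finset.subset_empty, ← Finset.card_eq_zero.1 h0]; exact hU
    subst this
    simp [ENNReal.div_self_le_one]
  have hmR : (0 : ℝ) < m := by exact_mod_cast hpos
  have hρ0 : 0 ≤ ρ := by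
    by_contra h
    have : ρ * m < 0 := mul_neg_of_neg_of_pos (not_le.1 h) hmR
    have : (0 : ℝ) ≤ ((m - L : ℕ) : ℝ) := by positivity
    linarith
  -- The late positions: no vertex of `U` chooses exactly when the inverse permutation maps `U` into
  -- `W`.
  let W : Finset (Fin m) := Finset.univ.filter fun k => ¬(k : ℕ) < L
  have hW : W.card = m - L := by
    simp only [W, not_lt]
    rw [← Finset.card_map Fin.valEmbedding]
    rw [← Nat.card_Ico L m]
    congr 1
    ext k
    simp only [Finset.mem_map, Finset.mem_filter, Finset.mem_univ, true_and, Fin.valEmbedding_apply,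
      Finset.mem_Ico]
    exact ⟨fun ⟨a, ha, hk⟩ => by omega, fun h => ⟨⟨k, h.2⟩, h.1, rfl⟩⟩
  let U' : Finset S := U.subtype (· ∈ S)
  have hU' : U'.card = U.card := by
    rw [Finset.card_subtype, Finset.filter_true_of_mem fun x hx => hU hx]
  have key := card_equiv_mapsTo_mul_le W U'
  rw [Fintype.card_coe, ← hm, hW, hU'] at key
  have hsum : ∑ π : Fin m ≃ S, ∏ x ∈ U, ind (x ∉ choosers π L) =
      ((Finset.univ.filter fun e : S ≃ Fin m => ∀ x ∈ U', e x ∈ W).card : ℝ≥0∞) := by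
    rw [← Finset.sum_boole]
    refine Fintype.sum_equiv ⟨Equiv.symm, Equiv.symm, Equiv.symm_symm, Equiv.symm_symm⟩ _ _
      fun π => ?_
    have hiff : (∀ x ∈ U', π.symm x ∈ W) ↔ ∀ x ∈ U, x ∉ choosers π L := by
      constructor
      · intro h x hx
        have := h ⟨x, hU hx⟩ (by simpa [U'] using hx)
        simp only [W, Finset.mem_filter, Finset.mem_univ, true_and] at this
        rwa [← mem_choosers] at this
      · intro h x hx
        simp only [W, Finset.mem_filter, Finset.mem_univ, true_and]
        rw [← mem_choosers]
        exact h x (by simpa [U'] using hx)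
    by_cases hall : ∀ x ∈ U, x ∉ choosers π L
    · rw [if_pos (by simpa using hiff.2 hall)]
      exact Finset.prod_eq_one fun x hx => ind_of_true (hall x hx)
    · rw [if_neg (by simpa using fun h => hall (hiff.1 h))]
      push Not at hall
      obtain ⟨x, hx, hx'⟩ := hall
      exact Finset.prod_eq_zero hx (ind_of_false (not_not.2 hx'))
  have hcard : Fintype.card (Fin m ≃ S) = Fintype.card (S ≃ Fin m) :=
    Fintype.card_congr ⟨Equiv.symm, Equiv.symm, Equiv.symm_symm, Equiv.symm_symm⟩
  rw [hsum, hcard]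
  set N := (Finset.univ.filter fun e : S ≃ Fin m => ∀ x ∈ U', e x ∈ W).card
  set F := Fintype.card (S ≃ Fin m) with hF
  have hFpos : 0 < F := Fintype.card_pos_iff.2 ⟨S.equivFin⟩
  have hFR : (0 : ℝ) < F := by exact_mod_cast hFpos
  have hkey : (N : ℝ) * m ^ U.card ≤ F * ((m - L : ℕ) : ℝ) ^ U.card := by
    have : N * m ^ U.card ≤ F * (m - L) ^ U.card := by convert key
    exact_mod_cast this
  have hfin : (N : ℝ) / F ≤ ρ ^ U.card := by
    rw [div_le_iff₀ hFR]
    have h1 : (N : ℝ) * m ^ U.card ≤ F * (ρ * m) ^ U.card := by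
      refine hkey.trans ?_
      gcongr
    rw [mul_pow, ← mul_assoc] at h1
    have := le_of_mul_le_mul_right h1 (by positivity)
    linarith
  calc (N : ℝ≥0∞) / F = ENNReal.ofReal ((N : ℝ) / F) := by
        rw [ENNReal.ofReal_div_of_pos hFR]; simp
    _ ≤ _ := by
        rw [← ENNReal.ofReal_pow hρ0]
        exact ENNReal.ofReal_le_ofReal hfin

/-- For a fixed permutation only the choosers contribute a factor `D / R`. Bounding each factor by
`ind (x ∉ choosers) + D / R`, expanding over the set `U` of non-choosers and averaging over the
permutation gives `ρ ^ |U|` termwise, hence `(D / R + ρ) ^ |T|`. -/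
theorem expect_cliqueChoice_le {P B : V → Finset C} {γ : ℝ} {S T : Finset V} {D R ρ : ℝ}
    (hR : 0 < R) (hD : 0 ≤ D) (hρ : 0 ≤ ρ) (hTS : T ⊆ S) (hγ : 1 - γ ≤ ρ)
    (hP : ∀ x ∈ T, (min ⌈(S.card : ℝ) * γ⌉₊ S.card : ℕ) + R ≤ (P x).card + 1)
    (hB : ∀ x ∈ T, ((B x).card : ℝ) ≤ D) :
    expect (cliqueChoice P γ S)
        (fun A => ∏ x ∈ T, ind (A x = none ∨ ∃ c ∈ B x, A x = some c)) ≤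
      ENNReal.ofReal (D / R + ρ) ^ T.card := by
  set L := ⌈(S.card : ℝ) * γ⌉₊ with hL
  set θ := ENNReal.ofReal (D / R) with hθ
  have : Nonempty (Fin S.card ≃ S) := ⟨S.equivFin.symm⟩
  have hun : ((S.card - L : ℕ) : ℝ) ≤ ρ * S.card ∨ S.card = 0 ∨ S.card ≤ L := by
    by_cases h : S.card ≤ L
    · exact Or.inr (Or.inr h)
    · left
      rw [Nat.cast_sub (not_le.1 h).le]
      have h1 : (S.card : ℝ) * γ ≤ L := Nat.le_ceil _
      have h2 : (0 : ℝ) ≤ S.card := by positivity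
      nlinarith
  rw [cliqueChoice_eq, expect_bind]
  have hinner : ∀ π : Fin S.card ≃ S,
      expect (sequentialChoice P (choosers π L) fun _ => none)
        (fun A => ∏ x ∈ T, ind (A x = none ∨ ∃ c ∈ B x, A x = some c)) ≤
      ∏ x ∈ T, if x ∈ choosers π L then θ else 1 := by
    intro π
    have hconv : ∀ f : V → ℝ≥0∞, ((choosers π L).map fun x => if x ∈ T then f x else 1).prod =
        ∏ x ∈ T, if x ∈ choosers π L then f x else 1 := by
      intro f
      rw [← List.prod_toFinset _ (nodup_choosers π L), ← Finset.prod_filter, ← Finset.prod_filter]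
      refine Finset.prod_congr ?_ fun _ _ => rfl
      ext x; simp [and_comm]
    rw [← hconv fun _ => θ]
    refine le_trans (expect_mono fun A _ => ?_) (expect_sequentialChoice_le (T := T) hR
      (nodup_choosers π L) (B := B) (fun x _ hxT => ?_) fun x _ hxT => hB x hxT)
    · rw [hconv fun x => ind (A x = none ∨ ∃ c ∈ B x, A x = some c)]
      refine Finset.prod_le_prod' fun x _ => ?_
      split_ifs
      · exact le_rfl
      · exact ind_le_one _
    · rw [length_choosers]
      simpa [colored] using hP x hxT
  calc _ ≤ expect (PMF.uniformOfFintype (Fin S.card ≃ S)) (fun π =>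
        ∑ U ∈ T.powerset, θ ^ (T \ U).card * ∏ x ∈ U, ind (x ∉ choosers π L)) := by
        refine expect_mono fun π _ => (hinner π).trans ?_
        calc _ ≤ ∏ x ∈ T, (ind (x ∉ choosers π L) + θ) := by
              refine Finset.prod_le_prod' fun x _ => ?_
              split_ifs with h
              · exact le_add_self
              · rw [ind_of_true h]; exact le_self_add
          _ = _ := by
              rw [Finset.prod_add]
              refine Finset.sum_congr rfl fun U _ => ?_
              rw [Finset.prod_const, mul_comm]
    _ = ∑ U ∈ T.powerset, θ ^ (T \ U).card *
          expect (PMF.uniformOfFintype (Fin S.card ≃ S)) fun π =>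
            ∏ x ∈ U, ind (x ∉ choosers π L) := by
        rw [expect_sum]
        exact Finset.sum_congr rfl fun U _ => expect_const_mul _
    _ ≤ ∑ U ∈ T.powerset, θ ^ (T \ U).card * ENNReal.ofReal ρ ^ U.card := by
        refine Finset.sum_le_sum fun U hU => ?_
        have hUT := Finset.mem_powerset.1 hU
        gcongr
        rcases hun with hun | hun
        · rw [expect_uniformOfFintype]
          convert sum_ind_not_chooser_le L hun U (hUT.trans hTS)
        · rcases U.eq_empty_or_nonempty with rfl | ⟨x, hx⟩
          · simp [expect_const]
          · have hxS := hTS (hUT hx)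
            have hcS : S.card ≠ 0 := Finset.card_ne_zero_of_mem hxS
            have hSL := hun.resolve_left hcS
            refine (expect_le_of_forall (c := 0) fun π _ => ?_).trans zero_le
            rw [Finset.prod_eq_zero hx]
            apply ind_of_false
            rw [not_not, show x = ((⟨x, hxS⟩ : S) : V) from rfl, mem_choosers]
            exact (π.symm _).2.trans_le hSL
    _ = (ENNReal.ofReal ρ + θ) ^ T.card := by
        rw [← Finset.sum_pow_mul_eq_add_pow]
        refine Finset.sum_congr rfl fun U hU => ?_
        rw [mul_comm, Finset.card_sdiff_of_subset (Finset.mem_powerset.1 hU)]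
    _ ≤ _ := by
        rw [hθ, add_comm, ← ENNReal.ofReal_add (by positivity) hρ]

end Choice

/-! ### One dense coloring step -/

section Step

variable {V : Type u} [Fintype V] {C : Type v} {G : SimpleGraph V} {pal : V → Finset C}
  {ε γ : ℝ} {ID : V → ℕ} {χ : V → Option C}

/-- The uncolored dense neighbors of `x` outside of the almost-clique of `x`. -/
noncomputable def externalNeighbors (G : SimpleGraph V) (ε : ℝ) (χ : V → Option C) (x : V) :
    Finset V :=
  (uncoloredDenseNeighbors G ε χ x).filter fun y =>
    (friendGraph G ε).connectedComponentMk y ≠ (friendGraph G ε).connectedComponentMk x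

/-- The uncolored members of the almost-clique of `x` that are not adjacent to `x`. -/
noncomputable def antiNeighbors (G : SimpleGraph V) (ε : ℝ) (χ : V → Option C) (x : V) :
    Finset V :=
  (almostClique G ε χ ((friendGraph G ε).connectedComponentMk x)).filter fun y => ¬G.Adj x y

/-- The uncolored neighbors of `x` that are not dense. -/
noncomputable def sparseNeighbors (G : SimpleGraph V) (ε : ℝ) (χ : V → Option C) (x : V) :
    Finset V :=
  Finset.univ.filter fun y => G.Adj x y ∧ ¬IsDense G ε y ∧ χ y = none

theorem mem_externalNeighbors {x y : V} : y ∈ externalNeighbors G ε χ x ↔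
    (G.Adj x y ∧ IsDense G ε y ∧ χ y = none) ∧
      (friendGraph G ε).connectedComponentMk y ≠ (friendGraph G ε).connectedComponentMk x := by
  simp [externalNeighbors, uncoloredDenseNeighbors]

theorem mem_almostClique {j : (friendGraph G ε).ConnectedComponent} {y : V} :
    y ∈ almostClique G ε χ j ↔
      IsDense G ε y ∧ χ y = none ∧ (friendGraph G ε).connectedComponentMk y = j := by
  simp [almostClique]

theorem mem_antiNeighbors {x y : V} : y ∈ antiNeighbors G ε χ x ↔
    (IsDense G ε y ∧ χ y = none ∧
      (friendGraph G ε).connectedComponentMk y = (friendGraph G ε).connectedComponentMk x) ∧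
      ¬G.Adj x y := by
  simp [antiNeighbors, almostClique]

theorem mem_sparseNeighbors {x y : V} : y ∈ sparseNeighbors G ε χ x ↔
    G.Adj x y ∧ ¬IsDense G ε y ∧ χ y = none := by
  simp [sparseNeighbors]

/-- The tentative colors in conflict with `x`, when the almost-cliques choose the tentative
colorings `B`. -/
noncomputable def conflictColors (G : SimpleGraph V) (ε : ℝ) (ID : V → ℕ) (χ : V → Option C)
    (B : (friendGraph G ε).ConnectedComponent → V → Option C) (x : V) : Finset C :=
  ((externalNeighbors G ε χ x).filter fun y =>
    leaderID G ε ID χ ((friendGraph G ε).connectedComponentMk y) <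
      leaderID G ε ID χ ((friendGraph G ε).connectedComponentMk x)).biUnion fun y =>
    (B ((friendGraph G ε).connectedComponentMk y) y).toFinset

theorem card_conflictColors_le
    (B : (friendGraph G ε).ConnectedComponent → V → Option C) (x : V) :
    (conflictColors G ε ID χ B x).card ≤ (externalNeighbors G ε χ x).card := by
  refine (Finset.card_biUnion_le_card_mul _ _ 1 fun y _ => ?_).trans ?_
  · cases B ((friendGraph G ε).connectedComponentMk y) y <;> simp
  · rw [mul_one]; exact Finset.card_filter_le _ _

/-- Because leader IDs are compared strictly, a winning competitor lies in another almost-clique.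
Failure thus becomes a condition on the choice of the own clique, relative to a color set determined
by cliques with smaller leaders. -/
theorem denseCommit_eq_none_iff (B : (friendGraph G ε).ConnectedComponent → V → Option C) {x : V}
    (hx : χ x = none) :
    denseCommit G ε ID χ (fun y => B ((friendGraph G ε).connectedComponentMk y) y) x = none ↔
      B ((friendGraph G ε).connectedComponentMk x) x = none ∨
        ∃ c ∈ conflictColors G ε ID χ B x,
          B ((friendGraph G ε).connectedComponentMk x) x = some c := by
  unfold denseCommit
  rw [if_neg (not_not.2 hx)]
  split_ifs with h
  · simp only [true_iff]
    obtain ⟨y, hxy, hy, hχy, hA, hlt⟩ := h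
    cases hc : B ((friendGraph G ε).connectedComponentMk x) x with
    | none => exact Or.inl rfl
    | some c =>
      refine Or.inr ⟨c, ?_, rfl⟩
      rw [conflictColors, Finset.mem_biUnion]
      refine ⟨y, ?_, ?_⟩
      · rw [Finset.mem_filter, mem_externalNeighbors]
        refine ⟨⟨⟨hxy, hy, hχy⟩, fun h => ?_⟩, hlt⟩
        rw [h] at hlt
        exact lt_irrefl _ hlt
      · have hA' : B ((friendGraph G ε).connectedComponentMk y) y =
            B ((friendGraph G ε).connectedComponentMk x) x := hA
        rw [hA', hc]; simp
  · constructor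
    · exact Or.inl
    · rintro (h' | ⟨c, hc, hxc⟩)
      · exact h'
      · exfalso
        rw [conflictColors, Finset.mem_biUnion] at hc
        obtain ⟨y, hy, hcy⟩ := hc
        rw [Finset.mem_filter, mem_externalNeighbors] at hy
        refine h ⟨y, hy.1.1.1, hy.1.1.2.1, hy.1.1.2.2, ?_, hy.2⟩
        beta_reduce
        rw [hxc]
        simpa using hcy

/-- Ranking the cliques by leader ID makes `expect_independent_prod_le` applicable: with the other
cliques fixed, the conflict colors of a member are a fixed set of at most `D` colors, so the bound
for a single clique applies. -/
theorem expect_denseStep_le {T : Finset V} {D R ρ : ℝ} (hR : 0 < R) (hD : 0 ≤ D) (hρ : 0 ≤ ρ)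
    (hγ : 1 - γ ≤ ρ) (hT : ∀ x ∈ T, IsDense G ε x ∧ χ x = none)
    (hP : ∀ x ∈ T,
      (min ⌈((almostClique G ε χ ((friendGraph G ε).connectedComponentMk x)).card : ℝ) * γ⌉₊
        (almostClique G ε χ ((friendGraph G ε).connectedComponentMk x)).card : ℕ) + R ≤
        (residualPalette G pal χ x).card + 1)
    (hext : ∀ x ∈ T, ((externalNeighbors G ε χ x).card : ℝ) ≤ D) :
    expect (denseStep G pal ε ID γ χ) (fun χ' => ∏ x ∈ T, ind (χ' x = none)) ≤
      ENNReal.ofReal (D / R + ρ) ^ T.card := by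
  let comp : V → (friendGraph G ε).ConnectedComponent := (friendGraph G ε).connectedComponentMk
  let Tj : (friendGraph G ε).ConnectedComponent → Finset V := fun j => T.filter fun x => comp x = j
  let F : (friendGraph G ε).ConnectedComponent →
      ((friendGraph G ε).ConnectedComponent → V → Option C) → ℝ≥0∞ := fun j B =>
    ∏ x ∈ Tj j, ind (B j x = none ∨ ∃ c ∈ conflictColors G ε ID χ B x, B j x = some c)
  have hconf : ∀ j k : (friendGraph G ε).ConnectedComponent,
      ¬leaderID G ε ID χ k < leaderID G ε ID χ j → ∀ B b, ∀ x ∈ Tj j,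
      conflictColors G ε ID χ (Function.update B k b) x = conflictColors G ε ID χ B x := by
    intro j k hjk B b x hx
    have hxj : comp x = j := (Finset.mem_filter.1 hx).2
    refine Finset.biUnion_congr rfl fun y hy => ?_
    have hlt := (Finset.mem_filter.1 hy).2
    rw [Function.update_of_ne]
    rintro rfl
    exact hjk (hxj ▸ hlt)
  rw [denseStep, expect_map]
  calc _ = expect (independent fun j : (friendGraph G ε).ConnectedComponent =>
        cliqueChoice (residualPalette G pal χ) γ (almostClique G ε χ j))
          (fun B => ∏ j ∈ Finset.univ, F j B) := by
        congr 1
        funext B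
        rw [← Finset.prod_fiberwise T comp]
        refine Finset.prod_congr rfl fun j _ => Finset.prod_congr rfl fun x hx => ?_
        rw [denseCommit_eq_none_iff B (hT x (Finset.mem_filter.1 hx).1).2,
          show (friendGraph G ε).connectedComponentMk x = j from (Finset.mem_filter.1 hx).2]
    _ ≤ ∏ j, ENNReal.ofReal (D / R + ρ) ^ (Tj j).card := by
        refine expect_independent_prod_le _ (leaderID G ε ID χ) F _ ?_ ?_ _
        · intro j k hkj hjk B b
          refine Finset.prod_congr rfl fun x hx => ?_
          rw [hconf j k hjk B b x hx, Function.update_of_ne hkj.symm]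
        · intro j B
          refine (expect_mono fun b _ => ?_).trans (expect_cliqueChoice_le (T := Tj j)
            (B := conflictColors G ε ID χ B) hR hD hρ ?_ hγ ?_ ?_)
          · refine Finset.prod_le_prod' fun x hx => ?_
            rw [hconf j j (lt_irrefl _) B b x hx, Function.update_self]
          · intro x hx
            have := hT x (Finset.mem_filter.1 hx).1
            rw [mem_almostClique]
            exact ⟨this.1, this.2, (Finset.mem_filter.1 hx).2⟩
          · intro x hx
            rw [Finset.mem_filter] at hx
            have := hP x hx.1
            rwa [show (friendGraph G ε).connectedComponentMk x = j from hx.2] at this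
          · intro x hx
            refine le_trans ?_ (hext x (Finset.mem_filter.1 hx).1)
            exact_mod_cast card_conflictColors_le B x
    _ = _ := by
        rw [Finset.prod_pow_eq_pow_sum, Finset.card_eq_sum_card_fiberwise (f := comp)
          (t := Finset.univ) (by simp)]

theorem eq_of_mem_support_denseStep {χ' : V → Option C}
    (h : χ' ∈ (denseStep G pal ε ID γ χ).support) {x : V} (hx : χ x ≠ none) : χ' x = χ x := by
  rw [denseStep, PMF.mem_support_map_iff] at h
  obtain ⟨B, -, rfl⟩ := h
  rw [denseCommit, if_pos hx]

theorem eq_none_of_mem_support_denseStep {χ' : V → Option C}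
    (h : χ' ∈ (denseStep G pal ε ID γ χ).support) {x : V} (hx : χ' x = none) : χ x = none := by
  by_contra hne
  exact hne ((eq_of_mem_support_denseStep h hne).symm.trans hx)

theorem exists_choosers_of_mem_support_denseStep {χ' : V → Option C}
    (h : χ' ∈ (denseStep G pal ε ID γ χ).support) (j : (friendGraph G ε).ConnectedComponent) :
    ∃ π : Fin (almostClique G ε χ j).card ≃ almostClique G ε χ j,
      ∀ x, (friendGraph G ε).connectedComponentMk x = j → χ x = none →
        x ∉ choosers π ⌈((almostClique G ε χ j).card : ℝ) * γ⌉₊ → χ' x = none := by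
  rw [denseStep, PMF.mem_support_map_iff] at h
  obtain ⟨B, hB, rfl⟩ := h
  obtain ⟨π, hπ⟩ := mem_support_cliqueChoice (mem_support_of_independent _ hB j)
  refine ⟨π, fun x hxj hχ hx => ?_⟩
  rw [denseCommit_eq_none_iff B hχ, hxj]
  exact Or.inl (hπ x hx)

theorem sparse_eq_none_of_mem_support_denseStep {χ' : V → Option C}
    (h : χ' ∈ (denseStep G pal ε ID γ χ).support) {x : V} (hs : ¬IsDense G ε x)
    (hx : χ x = none) : χ' x = none := by
  obtain ⟨π, hπ⟩ := exists_choosers_of_mem_support_denseStep h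
    ((friendGraph G ε).connectedComponentMk x)
  refine hπ x rfl hx fun hmem => hs ?_
  exact (mem_almostClique.1 (mem_of_mem_choosers hmem)).1

/-- Only choosers can be colored, so the clique cannot shrink too fast. This is deterministic, so
the lower bound on clique sizes costs no probability. -/
theorem card_almostClique_le_of_mem_support_denseStep {χ' : V → Option C}
    (h : χ' ∈ (denseStep G pal ε ID γ χ).support) (j : (friendGraph G ε).ConnectedComponent) :
    (almostClique G ε χ j).card ≤ (almostClique G ε χ' j).card +
      ⌈((almostClique G ε χ j).card : ℝ) * γ⌉₊ := by
  obtain ⟨π, hπ⟩ := exists_choosers_of_mem_support_denseStep h j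
  set L := ⌈((almostClique G ε χ j).card : ℝ) * γ⌉₊
  have h1 : almostClique G ε χ j ⊆ almostClique G ε χ' j ∪ (choosers π L).toFinset := by
    intro x hx
    rw [Finset.mem_union, List.mem_toFinset]
    by_cases hmem : x ∈ choosers π L
    · exact Or.inr hmem
    · rw [mem_almostClique] at hx
      exact Or.inl (mem_almostClique.2 ⟨hx.1, hπ x hx.2.2 hx.2.1 hmem, hx.2.2⟩)
  refine (Finset.card_le_card h1).trans ((Finset.card_union_le _ _).trans ?_)
  gcongr
  rw [List.toFinset_card_of_nodup (nodup_choosers π L), length_choosers]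
  exact min_le_left _ _

theorem card_almostClique_add_card_sparseNeighbors_le (x : V) :
    (almostClique G ε χ ((friendGraph G ε).connectedComponentMk x)).card +
      (sparseNeighbors G ε χ x).card ≤
    (antiNeighbors G ε χ x).card + (Finset.univ.filter fun y => G.Adj x y ∧ χ y = none).card := by
  rw [antiNeighbors, ← Finset.card_filter_add_card_filter_not (s := almostClique G ε χ _)
    (fun y => G.Adj x y), add_comm (Finset.card _) (Finset.card _), add_assoc]
  gcongr
  rw [← Finset.card_union_of_disjoint]
  · refine Finset.card_le_card fun y hy => ?_
    rw [Finset.mem_union, Finset.mem_filter, mem_almostClique, mem_sparseNeighbors] at hy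
    rw [Finset.mem_filter]
    rcases hy with hy | hy
    · exact ⟨Finset.mem_univ _, hy.2, hy.1.2.1⟩
    · exact ⟨Finset.mem_univ _, hy.1, hy.2.2⟩
  · rw [Finset.disjoint_left]
    intro y hy hy'
    rw [Finset.mem_filter, mem_almostClique] at hy
    rw [mem_sparseNeighbors] at hy'
    exact hy'.2.1 hy.1.1

/-- Each colored neighbor removes at most one of at least `Δ + 1` colors, and there are at most `Δ`
neighbors. -/
theorem card_residualPalette_ge (hpal : ∀ x, maxDeg G + 1 ≤ (pal x).card) (x : V) :
    (Finset.univ.filter fun y => G.Adj x y ∧ χ y = none).card + 1 ≤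
      (residualPalette G pal χ x).card := by
  have h1 : (pal x).card ≤ (residualPalette G pal χ x).card +
      (Finset.univ.filter fun y => G.Adj x y ∧ χ y ≠ none).card := by
    rw [← Finset.card_filter_add_card_filter_not (s := pal x)
      fun c => ∀ y, G.Adj x y → χ y ≠ some c]
    unfold residualPalette
    gcongr
    rw [← Finset.card_map (s := (pal x).filter _) ⟨some, Option.some_injective C⟩]
    refine (Finset.card_le_card fun a ha => ?_).trans (Finset.card_image_le (f := χ))
    simp only [Finset.mem_map, Finset.mem_filter, not_forall, not_not] at ha
    obtain ⟨c, ⟨-, y, hxy, hy⟩, rfl⟩ := ha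
    exact Finset.mem_image.2 ⟨y, by simp [hxy, hy], hy⟩
  have h2 : (Finset.univ.filter fun y => G.Adj x y ∧ χ y = none).card +
      (Finset.univ.filter fun y => G.Adj x y ∧ χ y ≠ none).card ≤ maxDeg G := by
    refine le_trans (le_of_eq ?_) (G.degree_le_maxDegree x)
    rw [← G.card_neighborFinset_eq_degree,
      ← Finset.card_filter_add_card_filter_not (s := G.neighborFinset x) fun y => χ y = none]
    congr 2 <;> (ext y; simp)
  have := hpal x
  omega

end Step

/-! ### The structure of almost-cliques -/

section Structure

variable {V : Type u} [Fintype V] {C : Type v} {G : SimpleGraph V} {ε : ℝ} {χ : V → Option C}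

/-- The friends of a vertex. -/
noncomputable def friends (G : SimpleGraph V) (ε : ℝ) (x : V) : Finset V :=
  Finset.univ.filter fun y => IsFriend G ε x y

theorem isFriend_iff {x y : V} : IsFriend G ε x y ↔
    G.Adj x y ∧ (1 - ε) * (maxDeg G : ℝ) ≤ ((G.neighborFinset x ∩ G.neighborFinset y).card : ℝ) := by
  rw [IsFriend, ← Set.ncard_coe_finset]
  simp

theorem isDense_iff {x : V} :
    IsDense G ε x ↔ (1 - ε) * (maxDeg G : ℝ) ≤ ((friends G ε x).card : ℝ) := by
  rw [IsDense, ← Set.ncard_coe_finset]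
  simp [friends]

theorem friends_subset (x : V) : friends G ε x ⊆ G.neighborFinset x := by
  intro y hy
  rw [friends, Finset.mem_filter] at hy
  simpa using hy.2.1

theorem card_neighborFinset_le (x : V) : ((G.neighborFinset x).card : ℝ) ≤ maxDeg G := by
  rw [G.card_neighborFinset_eq_degree]
  exact_mod_cast G.degree_le_maxDegree x

theorem card_add_card_le_of_subset_neighborFinset {A B : Finset V} {x : V}
    (hA : A ⊆ G.neighborFinset x) (hB : B ⊆ G.neighborFinset x) :
    (A.card : ℝ) + B.card ≤ maxDeg G + (A ∩ B).card := by
  have h1 := Finset.card_union_add_card_inter A B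
  have h2 := Finset.card_le_card (Finset.union_subset hA hB)
  have h3 := card_neighborFinset_le (G := G) x
  have h4 : (A.card : ℝ) + B.card ≤ (G.neighborFinset x).card + (A ∩ B).card := by
    exact_mod_cast (by omega : A.card + B.card ≤ (G.neighborFinset x).card + (A ∩ B).card)
  linarith

/-- Two members of the same almost-clique share at least `(1 - 2 ε) Δ` neighbors. -/
theorem card_common_neighbors_ge (hε0 : 0 ≤ ε) (hε : ε < 1 / 5) (hΔ : 0 < maxDeg G) {x y : V}
    (hx : IsDense G ε x)
    (hxy : (friendGraph G ε).connectedComponentMk x = (friendGraph G ε).connectedComponentMk y) :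
    (1 - 2 * ε) * (maxDeg G : ℝ) ≤ ((G.neighborFinset x ∩ G.neighborFinset y).card : ℝ) := by
  have hΔR : (0 : ℝ) < maxDeg G := by exact_mod_cast hΔ
  rw [SimpleGraph.ConnectedComponent.eq, SimpleGraph.reachable_iff_reflTransGen] at hxy
  have hxF := isDense_iff.1 hx
  induction hxy with
  | refl =>
    rw [Finset.inter_self]
    have : ((friends G ε x).card : ℝ) ≤ (G.neighborFinset x).card := by
      exact_mod_cast Finset.card_le_card (friends_subset x)
    nlinarith
  | @tail y z _ hyz ih =>
    obtain ⟨-, hz, hyzF⟩ := hyz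
    have hyzN := (isFriend_iff.1 hyzF).2
    have hzF := isDense_iff.1 hz
    -- The path step first loses another `ε`: `x` and `z` share at least `(1 - 3ε)Δ` neighbors,
    -- which only serves to find a common friend.
    have h1 := card_add_card_le_of_subset_neighborFinset (G := G) (x := y)
      (A := G.neighborFinset x ∩ G.neighborFinset y) (B := G.neighborFinset y ∩ G.neighborFinset z)
      Finset.inter_subset_right Finset.inter_subset_left
    have h2 : (((G.neighborFinset x ∩ G.neighborFinset y) ∩
        (G.neighborFinset y ∩ G.neighborFinset z)).card : ℝ) ≤
        (G.neighborFinset x ∩ G.neighborFinset z).card := by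
      exact_mod_cast Finset.card_le_card fun w hw => by
        simp only [Finset.mem_inter] at hw ⊢
        exact ⟨hw.1.1, hw.2.2⟩
    have h3 := card_add_card_le_of_subset_neighborFinset (G := G) (x := x)
      (A := friends G ε x) (B := G.neighborFinset x ∩ G.neighborFinset z)
      (friends_subset x) Finset.inter_subset_left
    have h4 := card_add_card_le_of_subset_neighborFinset (G := G) (x := z)
      (A := friends G ε z) (B := friends G ε x ∩ (G.neighborFinset x ∩ G.neighborFinset z))
      (friends_subset z)
      (Finset.inter_subset_right.trans Finset.inter_subset_right)
    -- At least `(1 - 5ε)Δ > 0` common friends remain. Comparing `x` and `z` through one of them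
    -- resets the loss to `2ε`, so it does not accumulate along the path.
    have h5 : (0 : ℝ) < (friends G ε z ∩
        (friends G ε x ∩ (G.neighborFinset x ∩ G.neighborFinset z))).card := by
      nlinarith
    obtain ⟨w, hw⟩ := Finset.card_pos.1 (by exact_mod_cast h5)
    simp only [friends, Finset.mem_inter, Finset.mem_filter] at hw
    have h6 := (isFriend_iff.1 hw.2.1.2).2
    have h7 := (isFriend_iff.1 hw.1.2).2
    have h8 := card_add_card_le_of_subset_neighborFinset (G := G) (x := w)
      (A := G.neighborFinset x ∩ G.neighborFinset w) (B := G.neighborFinset z ∩ G.neighborFinset w)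
      Finset.inter_subset_right Finset.inter_subset_right
    have h9 : (((G.neighborFinset x ∩ G.neighborFinset w) ∩
        (G.neighborFinset z ∩ G.neighborFinset w)).card : ℝ) ≤
        (G.neighborFinset x ∩ G.neighborFinset z).card := by
      exact_mod_cast Finset.card_le_card fun w hw => by
        simp only [Finset.mem_inter] at hw ⊢
        exact ⟨hw.1.1, hw.2.1⟩
    linarith

/-- Double count the edges between the anti-neighbors and the friends of `x`. An anti-neighbor sees
at least `(1 - 3ε)Δ` friends, while a friend shares all but `εΔ` of its possible neighbors with `x`
and so sees at most `εΔ` anti-neighbors. Finally `1 / (1 - 3ε) ≤ 3`. -/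
theorem card_antiNeighbors_le (hε0 : 0 ≤ ε) (hε : ε < 1 / 5) (hΔ : 0 < maxDeg G) {x : V}
    (hx : IsDense G ε x) : ((antiNeighbors G ε χ x).card : ℝ) ≤ 3 * ε * maxDeg G := by
  have hΔR : (0 : ℝ) < maxDeg G := by exact_mod_cast hΔ
  have hxF := isDense_iff.1 hx
  set A := antiNeighbors G ε χ x with hA
  have hlow : ∀ y ∈ A, (1 - 3 * ε) * (maxDeg G : ℝ) ≤
      ((Finset.bipartiteAbove G.Adj (friends G ε x) y).card : ℝ) := by
    intro y hy
    have h1 := card_common_neighbors_ge hε0 hε hΔ hx (mem_antiNeighbors.1 hy).1.2.2.symm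
    have h2 := card_add_card_le_of_subset_neighborFinset (G := G) (x := x)
      (A := friends G ε x) (B := G.neighborFinset x ∩ G.neighborFinset y)
      (friends_subset x) Finset.inter_subset_left
    have h3 : ((friends G ε x ∩ (G.neighborFinset x ∩ G.neighborFinset y)).card : ℝ) ≤
        (Finset.bipartiteAbove G.Adj (friends G ε x) y).card := by
      exact_mod_cast Finset.card_le_card fun w hw => by
        simp only [Finset.mem_inter, SimpleGraph.mem_neighborFinset] at hw
        rw [Finset.mem_bipartiteAbove]
        exact ⟨hw.1, hw.2.2⟩
    linarith
  have hup : ∀ w ∈ friends G ε x, ((Finset.bipartiteBelow G.Adj A w).card : ℝ) ≤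
      ε * maxDeg G := by
    intro w hw
    have h1 := (isFriend_iff.1 (Finset.mem_filter.1 hw).2).2
    have h2 := card_add_card_le_of_subset_neighborFinset (G := G) (x := w)
      (A := G.neighborFinset x ∩ G.neighborFinset w) (B := Finset.bipartiteBelow G.Adj A w)
      Finset.inter_subset_right (fun y hy => by
        rw [Finset.mem_bipartiteBelow] at hy
        simpa using hy.2.symm)
    have h3 : (G.neighborFinset x ∩ G.neighborFinset w) ∩ Finset.bipartiteBelow G.Adj A w = ∅ := by
      rw [Finset.eq_empty_iff_forall_notMem]
      intro y hy
      simp only [Finset.mem_inter, SimpleGraph.mem_neighborFinset, Finset.mem_bipartiteBelow] at hy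
      exact (mem_antiNeighbors.1 hy.2.1).2 hy.1.1
    rw [h3, Finset.card_empty] at h2
    push_cast at h2
    linarith
  have hcount := Finset.sum_card_bipartiteAbove_eq_sum_card_bipartiteBelow (s := A)
    (t := friends G ε x) G.Adj
  have hcountR : ∑ y ∈ A, ((Finset.bipartiteAbove G.Adj (friends G ε x) y).card : ℝ) =
      ∑ w ∈ friends G ε x, ((Finset.bipartiteBelow G.Adj A w).card : ℝ) := by
    exact_mod_cast hcount
  have h1 : A.card * ((1 - 3 * ε) * (maxDeg G : ℝ)) ≤ (friends G ε x).card * (ε * maxDeg G) := by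
    rw [← nsmul_eq_mul, ← nsmul_eq_mul]
    exact (Finset.card_nsmul_le_sum _ _ _ hlow).trans
      (hcountR.trans_le (Finset.sum_le_card_nsmul _ _ _ hup))
  have h2 : ((friends G ε x).card : ℝ) ≤ maxDeg G := by
    refine le_trans ?_ (card_neighborFinset_le x)
    exact_mod_cast Finset.card_le_card (friends_subset x)
  have h3 : (A.card : ℝ) * (1 - 3 * ε) * maxDeg G ≤ (ε * maxDeg G) * maxDeg G := by
    have : (friends G ε x).card * (ε * maxDeg G) ≤ maxDeg G * (ε * maxDeg G) := by gcongr
    linarith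
  have h4 := le_of_mul_le_mul_right h3 hΔR
  have h5 : (0 : ℝ) ≤ A.card := by positivity
  nlinarith

/-- A dense friend of `x` lies in its component, so external neighbors are not friends, and at most
`εΔ` neighbors are not friends. -/
theorem card_externalNeighbors_le {x : V} (hx : IsDense G ε x) :
    ((externalNeighbors G ε χ x).card : ℝ) ≤ ε * maxDeg G := by
  have hxF := isDense_iff.1 hx
  have h2 := card_add_card_le_of_subset_neighborFinset (G := G) (x := x)
    (A := friends G ε x) (B := externalNeighbors G ε χ x) (friends_subset x) (fun y hy => by
        rw [mem_externalNeighbors] at hy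
        simpa using hy.1.1)
  have h3 : friends G ε x ∩ externalNeighbors G ε χ x = ∅ := by
    rw [Finset.eq_empty_iff_forall_notMem]
    intro y hy
    rw [Finset.mem_inter, friends, Finset.mem_filter, mem_externalNeighbors] at hy
    refine hy.2.2 (SimpleGraph.ConnectedComponent.eq.2 (SimpleGraph.Adj.reachable ?_))
    exact SimpleGraph.Adj.symm (G := friendGraph G ε) ⟨hx, hy.2.1.2.1, hy.1.2⟩
  rw [h3, Finset.card_empty] at h2
  push_cast at h2
  linarith

theorem card_uncoloredDenseNeighbors_le (x : V) :
    ((uncoloredDenseNeighbors G ε χ x).card : ℝ) ≤ maxDeg G := by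
  refine le_trans ?_ (card_neighborFinset_le (G := G) x)
  exact_mod_cast Finset.card_le_card fun y hy => by
    rw [uncoloredDenseNeighbors, Finset.mem_filter] at hy
    simpa using hy.2.1

/-- The uncolored neighbors of `x` are in its almost-clique, external, or sparse. -/
theorem card_uncolored_neighbors_le (x : V) :
    (Finset.univ.filter fun y => G.Adj x y ∧ χ y = none).card ≤
      (almostClique G ε χ ((friendGraph G ε).connectedComponentMk x)).card +
        (externalNeighbors G ε χ x).card + (sparseNeighbors G ε χ x).card := by
  refine le_trans (Finset.card_le_card (t := (almostClique G ε χ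
    ((friendGraph G ε).connectedComponentMk x) ∪ externalNeighbors G ε χ x) ∪
    sparseNeighbors G ε χ x) fun y hy => ?_) ((Finset.card_union_le _ _).trans ?_)
  · rw [Finset.mem_filter] at hy
    simp only [Finset.mem_union, mem_almostClique, mem_externalNeighbors, mem_sparseNeighbors]
    tauto
  · gcongr
    exact Finset.card_union_le _ _

end Structure

/-! ### The initial coloring step -/

section Initial

variable {V : Type u} [Fintype V] {C : Type v} {G : SimpleGraph V} {pal : V → Finset C} {ε : ℝ}

theorem expect_ind_bind_ne_none_le (n : ℕ) [NeZero n] (p : PMF (Option C)) :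
    expect ((PMF.uniformOfFintype (Fin n)).bind fun k => if k = 0 then p else PMF.pure none)
      (fun b => ind (b ≠ none)) ≤ 1 / (n : ℝ≥0∞) := by
  rw [expect_bind, expect_uniformOfFintype, Fintype.card_fin]
  gcongr
  calc _ ≤ ∑ k : Fin n, if k = 0 then (1 : ℝ≥0∞) else 0 := by
        refine Finset.sum_le_sum fun k _ => ?_
        split_ifs
        · exact expect_le_of_forall fun b _ => ind_le_one _
        · rw [expect_pure]
          exact (ind_of_false (by simp)).le
    _ = 1 := by simp

/-- Conflicts only remove colors, so being colored is dominated by the independent events of a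
non-blank tentative color. -/
theorem expect_initialStep_le (T : Finset V) :
    expect (initialStep G pal) (fun χ => ∏ x ∈ T, ind (χ x ≠ none)) ≤
      ENNReal.ofReal (1 / 100) ^ T.card := by
  rw [initialStep, expect_map]
  calc _ ≤ expect (independent fun x : V => (PMF.uniformOfFintype (Fin 100)).bind fun k =>
        if k = 0 then chooseUniform (pal x) else PMF.pure none)
          (fun A => ∏ x ∈ T, ind (A x ≠ none)) := by
        refine expect_mono fun A _ => Finset.prod_le_prod' fun x _ => ind_mono fun h hA => h ?_
        rw [initialCommit, hA]
        simp
    _ ≤ ∏ x ∈ T, ENNReal.ofReal (1 / 100) := by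
        refine expect_independent_prod_le _ (fun _ => 0) (fun x A => ind (A x ≠ none)) _ ?_ ?_ T
        · intro j k hkj _ A b
          rw [Function.update_of_ne hkj.symm]
        · intro j A
          simp only [Function.update_self]
          refine (expect_ind_bind_ne_none_le 100 _).trans_eq ?_
          rw [ENNReal.ofReal_div_of_pos (by norm_num)]
          simp
    _ = _ := by rw [Finset.prod_const]

theorem expect_initialStep_card_le (x : V) :
    expect (initialStep G pal) (fun χ => ind (4 * (1 / 100) * (maxDeg G : ℝ) <
      (((G.neighborFinset x).filter fun y => χ y ≠ none).card : ℝ))) ≤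
      ENNReal.ofReal (Real.exp (-(1 / 100 * (maxDeg G : ℝ)))) := by
  have h := expect_ind_lt_card_le (initialStep G pal) (G.neighborFinset x)
    (fun χ y => χ y ≠ none) (q := 1 / 100) (M := maxDeg G) (by norm_num)
    (card_neighborFinset_le x) fun T _ => expect_initialStep_le T
  convert h

end Initial

/-! ### The invariant of the dense coloring steps -/

section Invariant

variable {V : Type u} [Fintype V] {C : Type v} {G : SimpleGraph V} {pal : V → Finset C}
  {ε : ℝ} {ID : V → ℕ} {χ : V → Option C}

/-- The invariant: `D` bounds the number of uncolored vertices that are external neighbors or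
anti-neighbors of a dense vertex, `U` bounds its uncolored dense neighbors, and an almost-clique
has `Z` uncolored members unless its members have many uncolored sparse neighbors. -/
structure Invariant (G : SimpleGraph V) (ε D Z U : ℝ) (χ : V → Option C) : Prop where
  external : ∀ x, IsDense G ε x → ((externalNeighbors G ε χ x).card : ℝ) ≤ D
  anti : ∀ x, IsDense G ε x → ((antiNeighbors G ε χ x).card : ℝ) ≤ D
  dense : ∀ x, IsDense G ε x → ((uncoloredDenseNeighbors G ε χ x).card : ℝ) ≤ U
  size : ∀ x, IsDense G ε x → 3 / 10 * (maxDeg G : ℝ) ≤ (sparseNeighbors G ε χ x).card ∨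
    Z ≤ (almostClique G ε χ ((friendGraph G ε).connectedComponentMk x)).card

/-- The palette exceeds the clique size `m` by at least the sparse neighbors minus `D`. Many sparse
neighbors give slack `3Δ/10 - D ≥ Δ/5 ≥ s Z`. Otherwise `m ≥ Z`, and the non-choosers give about `2
s m - D ≥ s Z`, since `D = s² Z ≤ s Z`. -/
theorem Invariant.palette_ge {D Z U s : ℝ} (h : Invariant G ε D Z U χ)
    (hpal : ∀ x, maxDeg G + 1 ≤ (pal x).card) (hs0 : 0 < s) (hs : s ≤ 1 / 12)
    (hDZ : D = s ^ 2 * Z) (hZ0 : 0 < Z) (hZ : Z ≤ maxDeg G / 2) (hD : D ≤ maxDeg G / 10) {x : V}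
    (hx : IsDense G ε x) :
    (min ⌈((almostClique G ε χ ((friendGraph G ε).connectedComponentMk x)).card : ℝ) *
        (1 - 2 * s)⌉₊
      (almostClique G ε χ ((friendGraph G ε).connectedComponentMk x)).card : ℕ) + s * Z ≤
        (residualPalette G pal χ x).card + 1 := by
  set m := (almostClique G ε χ ((friendGraph G ε).connectedComponentMk x)).card with hm
  have h1 : (m : ℝ) + (sparseNeighbors G ε χ x).card + 1 ≤
      (antiNeighbors G ε χ x).card + (residualPalette G pal χ x).card := by
    have := card_almostClique_add_card_sparseNeighbors_le (G := G) (ε := ε) (χ := χ) x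
    have h2 := card_residualPalette_ge (χ := χ) hpal x
    exact_mod_cast (by omega : m + (sparseNeighbors G ε χ x).card + 1 ≤
      (antiNeighbors G ε χ x).card + (residualPalette G pal χ x).card)
  have h2 := h.anti x hx
  have hm0 : (0 : ℝ) ≤ m := by positivity
  rcases h.size x hx with h3 | h3
  · have h4 : ((min ⌈(m : ℝ) * (1 - 2 * s)⌉₊ m : ℕ) : ℝ) ≤ m := by
      exact_mod_cast min_le_right _ _
    nlinarith
  · have h4 : ((min ⌈(m : ℝ) * (1 - 2 * s)⌉₊ m : ℕ) : ℝ) ≤ m * (1 - 2 * s) + 1 := by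
      refine le_trans (Nat.cast_le.2 (min_le_left _ _)) (Nat.ceil_lt_add_one ?_).le
      exact mul_nonneg hm0 (by linarith)
    have h5 : (0 : ℝ) ≤ (sparseNeighbors G ε χ x).card := by positivity
    have h6 : s * Z ≤ s * m := by gcongr
    have h7 : D ≤ s * Z := by rw [hDZ]; nlinarith [mul_pos hs0 hZ0]
    linarith

/-- Sparse vertices are never colored here, and a clique of size `m ≥ Z` keeps at least `2 s m - 1 ≥
s Z` members. The hypothesis `1 ≤ s Z` absorbs the rounding. -/
theorem Invariant.size_of_mem_support {D Z U s : ℝ} (h : Invariant G ε D Z U χ)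
    (hs : s ≤ 1 / 12) (hZ : 1 ≤ s * Z) (hs0 : 0 < s) {χ' : V → Option C}
    (hχ' : χ' ∈ (denseStep G pal ε ID (1 - 2 * s) χ).support) (x : V) (hx : IsDense G ε x) :
    3 / 10 * (maxDeg G : ℝ) ≤ (sparseNeighbors G ε χ' x).card ∨
    s * Z ≤ (almostClique G ε χ' ((friendGraph G ε).connectedComponentMk x)).card := by
  rcases h.size x hx with h1 | h1
  · refine Or.inl (h1.trans ?_)
    exact_mod_cast Finset.card_le_card fun y hy => by
      rw [mem_sparseNeighbors] at hy ⊢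
      exact ⟨hy.1, hy.2.1, sparse_eq_none_of_mem_support_denseStep hχ' hy.2.1 hy.2.2⟩
  · right
    have h2 := card_almostClique_le_of_mem_support_denseStep hχ'
      ((friendGraph G ε).connectedComponentMk x)
    set m := (almostClique G ε χ ((friendGraph G ε).connectedComponentMk x)).card
    set m' := (almostClique G ε χ' ((friendGraph G ε).connectedComponentMk x)).card
    have hm0 : (0 : ℝ) ≤ m := by positivity
    have h3 : (⌈(m : ℝ) * (1 - 2 * s)⌉₊ : ℝ) < m * (1 - 2 * s) + 1 :=
      Nat.ceil_lt_add_one (mul_nonneg hm0 (by linarith))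
    have h4 : (m : ℝ) ≤ m' + ⌈(m : ℝ) * (1 - 2 * s)⌉₊ := by exact_mod_cast h2
    have h6 : s * Z ≤ s * m := by gcongr
    linarith

theorem Invariant.expect_denseStep_card_le {D Z U s : ℝ} (h : Invariant G ε D Z U χ)
    (hpal : ∀ x, maxDeg G + 1 ≤ (pal x).card) (hs0 : 0 < s) (hs : s ≤ 1 / 12)
    (hDZ : D = s ^ 2 * Z) (hZ0 : 0 < Z) (hZ : Z ≤ maxDeg G / 2) (hD : D ≤ maxDeg G / 10)
    {S : Finset V} (hS : ∀ x ∈ S, IsDense G ε x ∧ χ x = none) {M : ℝ} (hM : (S.card : ℝ) ≤ M)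
    (hDM : D ≤ M) :
    expect (denseStep G pal ε ID (1 - 2 * s) χ)
      (fun χ' => ind (12 * M * s < ((S.filter fun x => χ' x = none).card : ℝ))) ≤
      ENNReal.ofReal (Real.exp (-(3 * s * D))) := by
  have hD0 : 0 ≤ D := by rw [hDZ]; positivity
  -- Here `q = D / (s Z) + 2s = 3s`, so the threshold `4 q M` is the factor `12 s` of the recursion.
  have key := expect_ind_lt_card_le (denseStep G pal ε ID (1 - 2 * s) χ) S
    (fun χ' x => χ' x = none) (q := 3 * s) (M := M) (by positivity) hM fun T hT => by
      have := expect_denseStep_le (T := T) (D := D) (R := s * Z) (ρ := 2 * s) (ε := ε) (χ := χ)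
        (G := G) (pal := pal) (ID := ID) (γ := 1 - 2 * s) (by positivity) hD0 (by positivity)
        (by linarith) (fun x hx => hS x (hT hx))
        (fun x hx => h.palette_ge hpal hs0 hs hDZ hZ0 hZ hD (hS x (hT hx)).1)
        (fun x hx => h.external x (hS x (hT hx)).1)
      have hq : D / (s * Z) + 2 * s = 3 * s := by rw [hDZ]; field_simp; ring
      rwa [hq] at this
  refine le_trans (le_of_eq ?_) (key.trans ?_)
  · congr 1
    funext χ'
    rw [show 12 * M * s = 4 * (3 * s) * M by ring]
    congr!
  · apply ENNReal.ofReal_le_ofReal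
    apply Real.exp_le_exp.2
    have : 3 * s * D ≤ 3 * s * M := by gcongr
    linarith

/-- One dense coloring step preserves the invariant with high probability. -/
theorem Invariant.expect_denseStep_not_le {D Z U s : ℝ} (h : Invariant G ε D Z U χ)
    (hpal : ∀ x, maxDeg G + 1 ≤ (pal x).card) (hs0 : 0 < s) (hs : s ≤ 1 / 12)
    (hDZ : D = s ^ 2 * Z) (hsD : 1 ≤ s * D) (hZ : Z ≤ maxDeg G / 2) (hD : D ≤ maxDeg G / 10)
    (hDU : D ≤ U) :
    expect (denseStep G pal ε ID (1 - 2 * s) χ)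
      (fun χ' => ind (¬Invariant G ε (12 * D * s) (s * Z) (12 * U * s) χ')) ≤
      ENNReal.ofReal (3 * Fintype.card V * Real.exp (-(3 * s * D))) := by
  have hD0 : 0 < D := by
    by_contra hneg
    have := mul_nonneg hs0.le (neg_nonneg.2 (not_lt.1 hneg))
    linarith
  have hZ0 : 0 < Z := by
    by_contra hneg
    have := mul_nonneg (sq_nonneg s) (neg_nonneg.2 (not_lt.1 hneg))
    linarith
  have hsZ : 1 ≤ s * Z := by
    have h1 : s * D = s ^ 2 * (s * Z) := by rw [hDZ]; ring
    have h2 : s ^ 2 * (s * Z) ≤ 1 * (s * Z) := by gcongr; nlinarith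
    linarith
  set p := denseStep G pal ε ID (1 - 2 * s) χ with hp
  set e := ENNReal.ofReal (Real.exp (-(3 * s * D))) with he
  let Q1 : V → (V → Option C) → Prop := fun x χ' =>
    IsDense G ε x ∧ 12 * D * s < ((externalNeighbors G ε χ' x).card : ℝ)
  let Q2 : V → (V → Option C) → Prop := fun x χ' =>
    IsDense G ε x ∧ 12 * D * s < ((antiNeighbors G ε χ' x).card : ℝ)
  let Q3 : V → (V → Option C) → Prop := fun x χ' =>
    IsDense G ε x ∧ 12 * U * s < ((uncoloredDenseNeighbors G ε χ' x).card : ℝ)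
  have hbound : ∀ (x : V) (S : (V → Option C) → Finset V) (M : ℝ),
      (IsDense G ε x → ((S χ).card : ℝ) ≤ M) → D ≤ M →
      (∀ y ∈ S χ, IsDense G ε y ∧ χ y = none) →
      (∀ χ' ∈ p.support, S χ' ⊆ (S χ).filter fun y => χ' y = none) →
      expect p (fun χ' => ind (IsDense G ε x ∧ 12 * M * s < ((S χ').card : ℝ))) ≤ e := by
    intro x S M hM hDM hS hsub
    by_cases hx : IsDense G ε x
    swap
    · exact (expect_le_of_forall fun χ' _ => (ind_of_false fun h => hx h.1).le).trans zero_le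
    refine le_trans (expect_mono fun χ' hχ' => ?_)
      (h.expect_denseStep_card_le hpal hs0 hs hDZ hZ0 hZ hD hS (hM hx) hDM)
    refine ind_mono fun hlt => hlt.2.trans_le ?_
    exact_mod_cast Finset.card_le_card (hsub χ' hχ')
  have h1 : ∀ x, expect p (fun χ' => ind (Q1 x χ')) ≤ e := by
    intro x
    refine hbound x (fun χ => externalNeighbors G ε χ x) D (h.external x) le_rfl
      (fun y hy => (mem_externalNeighbors.1 hy).1.2) fun χ' hχ' y hy => ?_
    rw [mem_externalNeighbors] at hy
    rw [Finset.mem_filter, mem_externalNeighbors]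
    exact ⟨⟨⟨hy.1.1, hy.1.2.1, eq_none_of_mem_support_denseStep hχ' hy.1.2.2⟩, hy.2⟩, hy.1.2.2⟩
  have h2 : ∀ x, expect p (fun χ' => ind (Q2 x χ')) ≤ e := by
    intro x
    refine hbound x (fun χ => antiNeighbors G ε χ x) D (h.anti x) le_rfl
      (fun y hy => ⟨(mem_antiNeighbors.1 hy).1.1, (mem_antiNeighbors.1 hy).1.2.1⟩)
      fun χ' hχ' y hy => ?_
    rw [mem_antiNeighbors] at hy
    rw [Finset.mem_filter, mem_antiNeighbors]
    exact ⟨⟨⟨hy.1.1, eq_none_of_mem_support_denseStep hχ' hy.1.2.1, hy.1.2.2⟩, hy.2⟩, hy.1.2.1⟩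
  have h3 : ∀ x, expect p (fun χ' => ind (Q3 x χ')) ≤ e := by
    intro x
    refine hbound x (fun χ => uncoloredDenseNeighbors G ε χ x) U (h.dense x) hDU
      (fun y hy => (Finset.mem_filter.1 hy).2.2) fun χ' hχ' y hy => ?_
    rw [uncoloredDenseNeighbors, Finset.mem_filter] at hy
    rw [Finset.mem_filter, uncoloredDenseNeighbors, Finset.mem_filter]
    exact ⟨⟨hy.1, hy.2.1, hy.2.2.1, eq_none_of_mem_support_denseStep hχ' hy.2.2.2⟩, hy.2.2.2⟩
  calc _ ≤ expect p (fun χ' => ind (∃ x, Q1 x χ' ∨ Q2 x χ' ∨ Q3 x χ')) := by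
        refine expect_mono fun χ' hχ' => ind_mono fun hnot => ?_
        by_contra hall
        push Not at hall
        refine hnot ⟨fun x hx => ?_, fun x hx => ?_, fun x hx => ?_,
          h.size_of_mem_support hs hsZ hs0 hχ'⟩
        · by_contra hlt; exact (hall x).1 ⟨hx, not_le.1 hlt⟩
        · by_contra hlt; exact (hall x).2.1 ⟨hx, not_le.1 hlt⟩
        · by_contra hlt; exact (hall x).2.2 ⟨hx, not_le.1 hlt⟩
    _ ≤ ∑ x, expect p (fun χ' => ind (Q1 x χ' ∨ Q2 x χ' ∨ Q3 x χ')) :=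
        expect_ind_exists_le fun x χ' => Q1 x χ' ∨ Q2 x χ' ∨ Q3 x χ'
    _ ≤ ∑ x : V, (e + (e + e)) := by
        refine Finset.sum_le_sum fun x _ => ?_
        refine (expect_mono fun χ' _ => (ind_or_le _ _).trans
          (add_le_add le_rfl (ind_or_le _ _))).trans ?_
        rw [expect_add, expect_add]
        exact add_le_add (h1 x) (add_le_add (h2 x) (h3 x))
    _ = _ := by
        rw [Finset.sum_const, Finset.card_univ, nsmul_eq_mul,
          ENNReal.ofReal_mul (by positivity), ENNReal.ofReal_mul (by positivity), ← he]
        simp only [ENNReal.ofReal_natCast, ENNReal.ofReal_ofNat]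
        ring

/-- After the initial step the invariant holds with high probability. -/
theorem expect_initialStep_not_invariant_le (hε0 : 0 ≤ ε) (hε : ε ≤ 1 / 100)
    (hΔ : 0 < maxDeg G) :
    expect (initialStep G pal) (fun χ =>
      ind (¬Invariant G ε (3 * ε * maxDeg G) (maxDeg G / 2) (maxDeg G) χ)) ≤
      ENNReal.ofReal (Fintype.card V * Real.exp (-(1 / 100 * (maxDeg G : ℝ)))) := by
  have hΔR : (0 : ℝ) < maxDeg G := by exact_mod_cast hΔ
  calc _ ≤ expect (initialStep G pal) (fun χ => ind (∃ x, 4 * (1 / 100) * (maxDeg G : ℝ) <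
        (((G.neighborFinset x).filter fun y => χ y ≠ none).card : ℝ))) := by
        refine expect_mono fun χ _ => ind_mono fun hnot => ?_
        by_contra hall
        push Not at hall
        refine hnot ⟨fun x hx => ?_, fun x hx => card_antiNeighbors_le hε0 (by linarith) hΔ hx,
          fun x hx => card_uncoloredDenseNeighbors_le x, fun x hx => ?_⟩
        · have := card_externalNeighbors_le (χ := χ) hx
          nlinarith
        · have h1 := card_externalNeighbors_le (χ := χ) hx
          have h2 : (((Finset.univ.filter fun y => G.Adj x y ∧ χ y = none).card : ℕ) : ℝ) ≤
              (almostClique G ε χ ((friendGraph G ε).connectedComponentMk x)).card +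
              (externalNeighbors G ε χ x).card + (sparseNeighbors G ε χ x).card := by
            exact_mod_cast card_uncolored_neighbors_le x
          have h3 := isDense_iff.1 hx
          have h4 : ((friends G ε x).card : ℝ) ≤
              ((Finset.univ.filter fun y => G.Adj x y ∧ χ y = none).card : ℝ) +
              ((G.neighborFinset x).filter fun y => χ y ≠ none).card := by
            have h5 := Finset.card_le_card (friends_subset (G := G) (ε := ε) x)
            rw [← Finset.card_filter_add_card_filter_not (s := G.neighborFinset x)
              fun y => χ y = none] at h5
            have h6 : (G.neighborFinset x).filter (fun y => χ y = none) =
              Finset.univ.filter fun y => G.Adj x y ∧ χ y = none := by ext y; simp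
            rw [h6] at h5
            exact_mod_cast h5
          have h7 := hall x
          -- At least `(1 - ε - 1/25)Δ ≥ 0.95 Δ` friends are uncolored and at most `0.01 Δ`
          -- neighbors are external, so clique and sparse neighbors cannot be below `0.5 Δ` and `0.3
          -- Δ` together.
          by_contra hcon
          push Not at hcon
          nlinarith
    _ ≤ ∑ x : V, ENNReal.ofReal (Real.exp (-(1 / 100 * (maxDeg G : ℝ)))) :=
        (expect_ind_exists_le _).trans (Finset.sum_le_sum fun x _ => expect_initialStep_card_le x)
    _ = _ := by
        rw [Finset.sum_const, Finset.card_univ, nsmul_eq_mul, ENNReal.ofReal_mul (by positivity)]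
        simp

end Invariant

/-! ### Estimates for the parameters -/

section Parameters

variable {K : ℝ} {Δ : ℕ}

theorem epsilon_pos (hK : 9 ≤ K) : 0 < epsilon K Δ := by unfold epsilon; positivity

theorem epsilon_le (hK : 9 ≤ K) : epsilon K Δ ≤ 1 / 100 := by
  unfold epsilon
  rw [div_le_div_iff₀ (by positivity) (by norm_num)]
  have h1 : (100 : ℝ) ^ (-√(Real.log Δ)) ≤ 1 :=
    Real.rpow_le_one_of_one_le_of_nonpos (by norm_num) (neg_nonpos.2 (Real.sqrt_nonneg _))
  nlinarith

/-- The ratio `δ i = D i / Z i`. -/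
noncomputable def ratio (K : ℝ) (Δ i : ℕ) : ℝ := (boundDZ K Δ i).1 / (boundDZ K Δ i).2

theorem boundDZ_pos (hK : 9 ≤ K) (hΔ : 0 < Δ) (i : ℕ) :
    0 < (boundDZ K Δ i).1 ∧ 0 < (boundDZ K Δ i).2 := by
  have hΔR : (0 : ℝ) < Δ := by exact_mod_cast hΔ
  induction i with
  | zero =>
    have := epsilon_pos (Δ := Δ) hK
    exact ⟨by simp only [boundDZ]; positivity, by simp only [boundDZ]; positivity⟩
  | succ i ih =>
    obtain ⟨h1, h2⟩ := ih
    exact ⟨by simp only [boundDZ]; positivity, by simp only [boundDZ]; positivity⟩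

theorem ratio_pos (hK : 9 ≤ K) (hΔ : 0 < Δ) (i : ℕ) : 0 < ratio K Δ i :=
  div_pos (boundDZ_pos hK hΔ i).1 (boundDZ_pos hK hΔ i).2

theorem boundDZ_fst_succ (i : ℕ) :
    (boundDZ K Δ (i + 1)).1 = 12 * (boundDZ K Δ i).1 * √(ratio K Δ i) := rfl

theorem boundDZ_fst_eq (hK : 9 ≤ K) (hΔ : 0 < Δ) (i : ℕ) :
    (boundDZ K Δ i).1 = √(ratio K Δ i) ^ 2 * (boundDZ K Δ i).2 := by
  rw [Real.sq_sqrt (ratio_pos hK hΔ i).le, ratio, div_mul_cancel₀ _ (boundDZ_pos hK hΔ i).2.ne']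

theorem boundDZ_snd_succ (hK : 9 ≤ K) (hΔ : 0 < Δ) (i : ℕ) :
    (boundDZ K Δ (i + 1)).2 = √(ratio K Δ i) * (boundDZ K Δ i).2 := by
  have h : (boundDZ K Δ (i + 1)).2 = (boundDZ K Δ i).1 / √(ratio K Δ i) := rfl
  have h1 := Real.sqrt_pos.2 (ratio_pos hK hΔ i)
  rw [h, boundDZ_fst_eq hK hΔ i]
  field_simp

theorem ratio_eq (hK : 9 ≤ K) (hΔ : 0 < Δ) (i : ℕ) :
    ratio K Δ i = 12 ^ i * (6 * epsilon K Δ) := by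
  have hΔR : (0 : ℝ) < Δ := by exact_mod_cast hΔ
  induction i with
  | zero => simp only [ratio, boundDZ]; field_simp; ring
  | succ i ih =>
    have h1 := Real.sqrt_pos.2 (ratio_pos hK hΔ i)
    have h2 := (boundDZ_pos hK hΔ i).2
    have h3 := (boundDZ_pos hK hΔ i).1
    have h4 : ratio K Δ (i + 1) = 12 * ratio K Δ i := by
      rw [ratio, boundDZ_fst_succ, boundDZ_snd_succ hK hΔ, ratio]
      field_simp
    rw [h4, ih]; ring

/-- The base 100 in `ε` pays for `12 ^ i` and still leaves `exp(-2√(ln Δ))`, because `12 e² < 100`.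
The constants `12² · 6 = 864` are absorbed by `100 K`, hence `K ≥ 9`. -/
theorem sqrt_ratio_le (hK : 9 ≤ K) (hΔ : 0 < Δ) {i : ℕ} (hi : i < ⌈√(Real.log Δ)⌉₊) :
    12 * √(ratio K Δ i) ≤ Real.exp (-√(Real.log Δ)) := by
  set r := √(Real.log Δ) with hr
  have hr0 : 0 ≤ r := Real.sqrt_nonneg _
  have hir : (i : ℝ) ≤ r := (Nat.lt_ceil.1 hi).le
  have h1 : (12 : ℝ) ^ i ≤ 12 ^ r := by
    rw [← Real.rpow_natCast]
    exact Real.rpow_le_rpow_of_exponent_le (by norm_num) hir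
  have h2 : (12 : ℝ) ^ r * 100 ^ (-r) ≤ Real.exp (-r) ^ 2 := by
    have h3 : (12 : ℝ) ^ r * Real.exp r ^ 2 ≤ 100 ^ r := by
      have h4 : Real.exp r ^ 2 = (Real.exp 1 ^ 2) ^ r := by
        rw [← Real.exp_nat_mul, ← Real.exp_nat_mul, ← Real.exp_mul]; congr 1; push_cast; ring
      rw [h4, ← Real.mul_rpow (by norm_num) (by positivity)]
      have h5 := Real.exp_one_lt_d9
      have h6 := Real.exp_pos 1
      exact Real.rpow_le_rpow (by positivity) (by nlinarith) hr0
    rw [Real.rpow_neg (by norm_num), Real.exp_neg, inv_pow, ← div_eq_mul_inv,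
      div_le_iff₀ (by positivity), inv_mul_eq_div, le_div_iff₀ (by positivity)]
    exact h3
  have h3 : (12 * √(ratio K Δ i)) ^ 2 ≤ Real.exp (-r) ^ 2 := by
    rw [mul_pow, Real.sq_sqrt (ratio_pos hK hΔ i).le, ratio_eq hK hΔ, epsilon, ← hr]
    calc (12 : ℝ) ^ 2 * (12 ^ i * (6 * (100 ^ (-r) / (100 * K))))
        = (12 ^ i * 100 ^ (-r)) * (864 / (100 * K)) := by field_simp; ring
      _ ≤ (12 ^ r * 100 ^ (-r)) * 1 := by
          gcongr
          rw [div_le_one (by positivity)]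
          linarith
      _ ≤ _ := by linarith
  exact le_of_sq_le_sq h3 (Real.exp_nonneg _)

theorem boundDZ_fst_le (hK : 9 ≤ K) (hΔ : 0 < Δ) {i : ℕ} (hi : i ≤ ⌈√(Real.log Δ)⌉₊) :
    (boundDZ K Δ i).1 ≤ 3 * epsilon K Δ * Δ * Real.exp (-√(Real.log Δ)) ^ i := by
  induction i with
  | zero => simp [boundDZ]
  | succ i ih =>
    have h1 := ih (by omega)
    have h2 := sqrt_ratio_le hK hΔ (i := i) (by omega)
    rw [boundDZ_fst_succ]
    calc 12 * (boundDZ K Δ i).1 * √(ratio K Δ i) = (boundDZ K Δ i).1 * (12 * √(ratio K Δ i)) := by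
          ring
      _ ≤ (3 * epsilon K Δ * Δ * Real.exp (-√(Real.log Δ)) ^ i) * Real.exp (-√(Real.log Δ)) := by
          have h3 := (boundDZ_pos hK hΔ i).1
          exact mul_le_mul h1 h2 (by positivity) (h3.le.trans h1)
      _ = _ := by ring

theorem sqrt_ratio_le_inv (hK : 9 ≤ K) (hΔ : 0 < Δ) {i : ℕ} (hi : i < ⌈√(Real.log Δ)⌉₊) :
    √(ratio K Δ i) ≤ 1 / 12 := by
  have h1 := sqrt_ratio_le hK hΔ hi
  have h2 : Real.exp (-√(Real.log Δ)) ≤ 1 := Real.exp_le_one_iff.2 (neg_nonpos.2 (Real.sqrt_nonneg _))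
  linarith

theorem boundDZ_fst_le_tenth (hK : 9 ≤ K) (hΔ : 0 < Δ) {i : ℕ} (hi : i ≤ ⌈√(Real.log Δ)⌉₊) :
    (boundDZ K Δ i).1 ≤ (Δ : ℝ) / 10 := by
  have h1 := boundDZ_fst_le hK hΔ hi
  have h2 : Real.exp (-√(Real.log Δ)) ^ i ≤ 1 := pow_le_one₀ (Real.exp_nonneg _)
    (Real.exp_le_one_iff.2 (neg_nonpos.2 (Real.sqrt_nonneg _)))
  have h3 := epsilon_pos (Δ := Δ) hK
  have h4 := epsilon_le (Δ := Δ) hK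
  have hΔR : (0 : ℝ) < Δ := by exact_mod_cast hΔ
  calc _ ≤ _ := h1
    _ ≤ 3 * epsilon K Δ * Δ * 1 := by gcongr
    _ ≤ _ := by nlinarith

theorem boundDZ_snd_le (hK : 9 ≤ K) (hΔ : 0 < Δ) {i : ℕ} (hi : i ≤ ⌈√(Real.log Δ)⌉₊) :
    (boundDZ K Δ i).2 ≤ (Δ : ℝ) / 2 := by
  induction i with
  | zero => simp [boundDZ]
  | succ i ih =>
    have h1 := ih (by omega)
    have h2 := sqrt_ratio_le_inv hK hΔ (i := i) (by omega)
    have h3 := (boundDZ_pos hK hΔ i).2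
    have h4 : √(ratio K Δ i) * (boundDZ K Δ i).2 ≤ 1 * (boundDZ K Δ i).2 := by
      gcongr; linarith
    rw [boundDZ_snd_succ hK hΔ]
    linarith

/-- The bound for the number of uncolored dense neighbors: it is `Δ` at first and shrinks in
proportion to `D i`. -/
noncomputable def boundU (K : ℝ) (Δ i : ℕ) : ℝ := (boundDZ K Δ i).1 / (3 * epsilon K Δ)

theorem boundU_zero (hK : 9 ≤ K) : boundU K Δ 0 = Δ := by
  have := epsilon_pos (Δ := Δ) hK
  simp only [boundU, boundDZ]; field_simp

theorem boundU_succ (i : ℕ) : boundU K Δ (i + 1) = 12 * boundU K Δ i * √(ratio K Δ i) := by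
  rw [boundU, boundDZ_fst_succ, boundU]; ring

theorem boundDZ_fst_le_boundU (hK : 9 ≤ K) (hΔ : 0 < Δ) (i : ℕ) :
    (boundDZ K Δ i).1 ≤ boundU K Δ i := by
  have h1 := epsilon_pos (Δ := Δ) hK
  have h2 := epsilon_le (Δ := Δ) hK
  rw [boundU, le_div_iff₀ (by positivity)]
  have := (boundDZ_pos hK hΔ i).1
  nlinarith

/-- With `r = √(ln Δ)`, each of `⌈r⌉` steps gains a factor `exp(-r)`, and `r ⌈r⌉ ≥ ln Δ`. -/
theorem boundU_last_le (hK : 9 ≤ K) (hΔ : 0 < Δ) : boundU K Δ ⌈√(Real.log Δ)⌉₊ ≤ 1 := by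
  have h1 := epsilon_pos (Δ := Δ) hK
  have hΔR : (0 : ℝ) < Δ := by exact_mod_cast hΔ
  have hΔ1 : (1 : ℝ) ≤ Δ := by exact_mod_cast hΔ
  rw [boundU, div_le_one (by positivity)]
  refine (boundDZ_fst_le hK hΔ le_rfl).trans ?_
  set r := √(Real.log Δ) with hr
  have hr0 : 0 ≤ r := Real.sqrt_nonneg _
  have h2 : Real.exp (-r) ^ ⌈r⌉₊ ≤ (Δ : ℝ)⁻¹ := by
    rw [← Real.exp_nat_mul, ← Real.exp_log (inv_pos.2 hΔR), Real.log_inv]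
    apply Real.exp_le_exp.2
    have h3 : r * r = Real.log Δ := Real.mul_self_sqrt (Real.log_nonneg hΔ1)
    have h4 := Nat.le_ceil r
    nlinarith
  calc 3 * epsilon K Δ * Δ * Real.exp (-r) ^ ⌈r⌉₊ ≤ 3 * epsilon K Δ * Δ * (Δ : ℝ)⁻¹ := by gcongr
    _ = _ := by field_simp

/-- Since `√(ratio)` is at least `ε`, failure of concentration forces `D ≤ c / ε`, so `D / (3ε)` is
at most `c / ε²`. The exponent 14 comes from `100² ≤ 2¹⁴`. -/
theorem boundU_le_of_lt (hK : 9 ≤ K) (hΔ : 0 < Δ) {i : ℕ} (hi : i < ⌈√(Real.log Δ)⌉₊) {c : ℝ}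
    (hc : √(ratio K Δ i) * (boundDZ K Δ i).1 < c) :
    boundU K Δ i ≤ c * (100 * K) ^ 2 * 2 ^ (14 * √(Real.log Δ)) := by
  have h1 := epsilon_pos (Δ := Δ) hK
  have hD := (boundDZ_pos hK hΔ i).1
  have h2 : epsilon K Δ ≤ √(ratio K Δ i) := by
    have h3 := sqrt_ratio_le_inv hK hΔ hi
    have h4 := Real.sqrt_nonneg (ratio K Δ i)
    have h5 := Real.sq_sqrt (ratio_pos hK hΔ i).le
    have h6 : 6 * epsilon K Δ ≤ ratio K Δ i := by
      rw [ratio_eq hK hΔ]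
      have : (1 : ℝ) ≤ 12 ^ i := one_le_pow₀ (by norm_num)
      nlinarith
    nlinarith
  have hc0 : 0 < c := lt_of_le_of_lt (by positivity) hc
  have h3 : epsilon K Δ * (boundDZ K Δ i).1 ≤ c := by
    refine le_trans ?_ hc.le
    gcongr
  have h4 : 1 ≤ epsilon K Δ ^ 2 * ((100 * K) ^ 2 * 2 ^ (14 * √(Real.log Δ))) := by
    rw [epsilon]
    set r := √(Real.log Δ) with hr
    have hr0 : 0 ≤ r := Real.sqrt_nonneg _
    have h5 : (100 : ℝ) ^ r ≤ 2 ^ (7 * r) := by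
      rw [Real.rpow_mul (by norm_num)]
      exact Real.rpow_le_rpow (by norm_num) (by norm_num) hr0
    have h6 : (2 : ℝ) ^ (14 * r) = (2 ^ (7 * r)) ^ 2 := by
      rw [← Real.rpow_mul_natCast (by norm_num)]; congr 1; push_cast; ring
    have h7 : (100 : ℝ) ^ (-r) * 100 ^ r = 1 := by
      rw [← Real.rpow_add (by norm_num)]; simp
    have h8 : 1 ≤ (100 : ℝ) ^ (-r) * 2 ^ (7 * r) := by
      rw [← h7]; gcongr
    rw [h6]
    calc (1 : ℝ) ≤ ((100 : ℝ) ^ (-r) * 2 ^ (7 * r)) ^ 2 := one_le_pow₀ h8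
      _ = _ := by field_simp
  rw [boundU, div_le_iff₀ (by positivity)]
  have h5 : epsilon K Δ * (boundDZ K Δ i).1 * 1 ≤
      c * (epsilon K Δ ^ 2 * ((100 * K) ^ 2 * 2 ^ (14 * √(Real.log Δ)))) := by gcongr
  have h6 : epsilon K Δ * (boundDZ K Δ i).1 ≤ epsilon K Δ *
      (c * (100 * K) ^ 2 * 2 ^ (14 * √(Real.log Δ)) * epsilon K Δ) := by
    calc _ = epsilon K Δ * (boundDZ K Δ i).1 * 1 := by ring
      _ ≤ _ := h5
      _ = _ := by ring
  have h7 := le_of_mul_le_mul_left h6 h1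
  have h8 : 0 ≤ c * (100 * K) ^ 2 * 2 ^ (14 * √(Real.log Δ)) * epsilon K Δ := by positivity
  linarith

end Parameters

/-! ### The whole process -/

section Coloring

variable {V : Type u} [Fintype V] {C : Type v} {G : SimpleGraph V} {pal : V → Finset C}
  {ID : V → ℕ} {K : ℝ}

/-- Union bound: the initial step fails with probability at most `n exp(-c)`, thanks to `Δ ≥ 100 c`,
and each dense step adds at most `3 n exp(-c)`. -/
theorem expect_coloringAfter_not_invariant_le (hK : 9 ≤ K) (hΔ : 0 < maxDeg G)
    (hpal : ∀ x, maxDeg G + 1 ≤ (pal x).card) {c : ℝ} (hc : 1 ≤ c)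
    (hcΔ : 100 * c ≤ maxDeg G) {i : ℕ} (hi : i ≤ ⌈√(Real.log (maxDeg G))⌉₊)
    (hlarge : ∀ k < i, c ≤ √(ratio K (maxDeg G) k) * (boundDZ K (maxDeg G) k).1) :
    expect (coloringAfter G pal ID K i) (fun χ => ind (¬Invariant G (epsilon K (maxDeg G))
      (boundDZ K (maxDeg G) i).1 (boundDZ K (maxDeg G) i).2 (boundU K (maxDeg G) i) χ)) ≤
      ENNReal.ofReal ((1 + 3 * i) * (Fintype.card V * Real.exp (-c))) := by
  induction i with
  | zero =>
    rw [boundU_zero hK]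
    refine (expect_initialStep_not_invariant_le (epsilon_pos hK).le (epsilon_le hK) hΔ).trans ?_
    apply ENNReal.ofReal_le_ofReal
    have : Real.exp (-(1 / 100 * (maxDeg G : ℝ))) ≤ Real.exp (-c) :=
      Real.exp_le_exp.2 (by linarith)
    calc _ ≤ (Fintype.card V : ℝ) * Real.exp (-c) := by gcongr
      _ = _ := by simp
  | succ i ih =>
    have h1 := ih (by omega) fun k hk => hlarge k (by omega)
    have h2 := hlarge i (by omega)
    set Δ := maxDeg G with hΔdef
    set s := √(ratio K Δ i) with hs
    have hs0 : 0 < s := Real.sqrt_pos.2 (ratio_pos hK hΔ i)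
    set Q := Invariant G (epsilon K Δ) (boundDZ K Δ i).1 (boundDZ K Δ i).2 (boundU K Δ i)
      (C := C) with hQ
    rw [boundDZ_fst_succ, boundDZ_snd_succ hK hΔ, boundU_succ, ← hs]
    have hstep : ∀ χ, expect (denseStep G pal (epsilon K Δ) ID (gamma K Δ i) χ)
        (fun χ' => ind (¬Invariant G (epsilon K Δ) (12 * (boundDZ K Δ i).1 * s)
          (s * (boundDZ K Δ i).2) (12 * boundU K Δ i * s) χ')) ≤
        ind (¬Q χ) + ENNReal.ofReal (3 * (Fintype.card V * Real.exp (-c))) := by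
      intro χ
      rw [show gamma K Δ i = 1 - 2 * s from rfl]
      by_cases hχ : Q χ
      · refine le_trans (le_trans (Invariant.expect_denseStep_not_le hχ hpal hs0
          (sqrt_ratio_le_inv hK hΔ (by omega)) (boundDZ_fst_eq hK hΔ i) (by linarith)
          (boundDZ_snd_le hK hΔ (by omega)) (boundDZ_fst_le_tenth hK hΔ (by omega))
          (boundDZ_fst_le_boundU hK hΔ i)) ?_) le_add_self
        apply ENNReal.ofReal_le_ofReal
        rw [mul_assoc]
        gcongr
        linarith
      · rw [ind_of_true hχ]
        exact (expect_le_of_forall fun χ' _ => ind_le_one _).trans le_self_add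
    rw [coloringAfter, expect_bind]
    refine (expect_mono fun χ _ => hstep χ).trans ?_
    rw [expect_add, expect_const]
    refine (add_le_add h1 le_rfl).trans ?_
    rw [← ENNReal.ofReal_add (by positivity) (by positivity)]
    apply ENNReal.ofReal_le_ofReal
    push_cast
    linarith

/-- The number of uncolored dense neighbors never increases. -/
theorem expect_coloringAfter_dense_antitone (ε M : ℝ) {i j : ℕ} (hij : i ≤ j) :
    expect (coloringAfter G pal ID K j) (fun χ => ind (¬∀ x, IsDense G ε x →
      ((uncoloredDenseNeighbors G ε χ x).card : ℝ) ≤ M)) ≤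
    expect (coloringAfter G pal ID K i) (fun χ => ind (¬∀ x, IsDense G ε x →
      ((uncoloredDenseNeighbors G ε χ x).card : ℝ) ≤ M)) := by
  induction j, hij using Nat.le_induction with
  | base => exact le_rfl
  | succ j _ ih =>
    refine le_trans ?_ ih
    rw [coloringAfter, expect_bind]
    refine expect_mono fun χ _ => expect_le_of_forall fun χ' hχ' => ind_mono (mt fun h x hx => ?_)
    refine le_trans ?_ (h x hx)
    exact_mod_cast Finset.card_le_card fun y hy => by
      rw [uncoloredDenseNeighbors, Finset.mem_filter] at hy ⊢
      exact ⟨hy.1, hy.2.1, hy.2.2.1, eq_none_of_mem_support_denseStep hχ' hy.2.2.2⟩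

/-- There is a step up to which the bounds are large enough for concentration, and where the bound
for the uncolored dense neighbors is as small as required. -/
theorem exists_stopping_step {Δ : ℕ} (hK : 9 ≤ K) (hΔ : 0 < Δ) {c : ℝ} (hc : 1 ≤ c) :
    ∃ i ≤ ⌈√(Real.log Δ)⌉₊, (∀ k < i, c ≤ √(ratio K Δ k) * (boundDZ K Δ k).1) ∧
      boundU K Δ i ≤ c * (100 * K) ^ 2 * 2 ^ (14 * √(Real.log Δ)) := by
  -- Stop at the first step where concentration fails; if there is none, all steps succeed and the
  -- bound is already at most 1.
  by_cases h : ∃ i, i < ⌈√(Real.log Δ)⌉₊ ∧ √(ratio K Δ i) * (boundDZ K Δ i).1 < c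
  · obtain ⟨h1, h2⟩ := Nat.find_spec h
    refine ⟨Nat.find h, h1.le, fun k hk => ?_, boundU_le_of_lt hK hΔ h1 h2⟩
    by_contra hlt
    exact Nat.find_min h hk ⟨hk.trans h1, not_le.1 hlt⟩
  · push Not at h
    refine ⟨_, le_rfl, h, (boundU_last_le hK hΔ).trans ?_⟩
    have h1 : (1 : ℝ) ≤ 2 ^ (14 * √(Real.log Δ)) :=
      Real.one_le_rpow (by norm_num) (by positivity)
    have h2 : (1 : ℝ) ≤ (100 * K) ^ 2 := one_le_pow₀ (by linarith)
    exact one_le_mul_of_one_le_of_one_le (one_le_mul_of_one_le_of_one_le hc h2) h1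

/-- The extra 5 in the exponent absorbs the union bound over vertices and steps, as `(1 + 3t) n ≤ 4
n² ≤ n⁵`. -/
theorem failure_le {n t : ℕ} (hn : 2 ≤ n) (ht : t ≤ n) {K' : ℝ} :
    (1 + 3 * (t : ℝ)) * (n * Real.exp (-((K' + 5) * Real.log n))) ≤ (n : ℝ) ^ (-K') := by
  have hnR : (2 : ℝ) ≤ n := by exact_mod_cast hn
  have htR : (t : ℝ) ≤ n := by exact_mod_cast ht
  have hn0 : (0 : ℝ) < n := by linarith
  have h1 : Real.exp (-((K' + 5) * Real.log n)) = (n : ℝ) ^ (-K') * ((n : ℝ) ^ 5)⁻¹ := by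
    rw [Real.rpow_def_of_pos hn0, ← Real.rpow_natCast, ← Real.rpow_neg hn0.le,
      Real.rpow_def_of_pos hn0, ← Real.exp_add]
    congr 1; push_cast; ring
  rw [h1]
  have h2 : (0 : ℝ) ≤ (n : ℝ) ^ (-K') := by positivity
  have h3 : (1 + 3 * (t : ℝ)) * n ≤ (n : ℝ) ^ 5 := by
    have h4 : (4 : ℝ) ≤ n ^ 2 := by nlinarith
    calc (1 + 3 * (t : ℝ)) * n ≤ (4 * n) * n := by gcongr; linarith
      _ = 4 * n ^ 2 * 1 := by ring
      _ ≤ n ^ 2 * n ^ 2 * n := by gcongr; linarith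
      _ = _ := by ring
  calc _ = (n : ℝ) ^ (-K') * (((1 + 3 * (t : ℝ)) * n) / n ^ 5) := by ring
    _ ≤ (n : ℝ) ^ (-K') * 1 := by
        gcongr
        exact (div_le_one (by positivity)).2 h3
    _ = _ := mul_one _

theorem ofReal_le_toOuterMeasure_coloringAfter {K' : ℝ} (hK' : 0 < K') (hK : K' + 9 ≤ K)
    (hpal : ∀ x, maxDeg G + 1 ≤ (pal x).card)
    (hKG : K * Real.log (Fintype.card V) ≤ epsilon K (maxDeg G) ^ 4 * maxDeg G) :
    ENNReal.ofReal (1 - (Fintype.card V : ℝ) ^ (-K')) ≤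
      (coloringAfter G pal ID K ⌈√(Real.log (maxDeg G))⌉₊).toOuterMeasure
        {χ | ∀ x, IsDense G (epsilon K (maxDeg G)) x →
          ((uncoloredDenseNeighbors G (epsilon K (maxDeg G)) χ x).card : ℝ) ≤
            ((K' + 5) * (100 * K) ^ 2) * Real.log (Fintype.card V) *
              2 ^ (14 * √(Real.log (maxDeg G)))} := by
  set n := Fintype.card V with hn
  set p := coloringAfter G pal ID K ⌈√(Real.log (maxDeg G))⌉₊ with hp
  rw [toOuterMeasure_eq_expect]
  have hadd := expect_ind_add_expect_ind_not (p := p) fun χ => χ ∈ {χ : V → Option C |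
    ∀ x, IsDense G (epsilon K (maxDeg G)) x →
      ((uncoloredDenseNeighbors G (epsilon K (maxDeg G)) χ x).card : ℝ) ≤
        ((K' + 5) * (100 * K) ^ 2) * Real.log n * 2 ^ (14 * √(Real.log (maxDeg G)))}
  suffices hfail : expect p (fun χ => ind (χ ∉ {χ : V → Option C |
      ∀ x, IsDense G (epsilon K (maxDeg G)) x →
        ((uncoloredDenseNeighbors G (epsilon K (maxDeg G)) χ x).card : ℝ) ≤
          ((K' + 5) * (100 * K) ^ 2) * Real.log n * 2 ^ (14 * √(Real.log (maxDeg G)))})) ≤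
      ENNReal.ofReal ((n : ℝ) ^ (-K')) by
    rw [ENNReal.ofReal_sub _ (by positivity), ENNReal.ofReal_one, ← hadd]
    exact tsub_le_iff_right.2 (add_le_add le_rfl hfail)
  -- With at most one vertex `ln n = 0`, so the bound is 0, and it holds because there are no
  -- neighbors.
  rcases Nat.lt_or_ge n 2 with hn2 | hn2
  · have hsub : Subsingleton V := Fintype.card_le_one_iff_subsingleton.1 (by omega)
    refine (expect_le_of_forall (c := 0) fun χ _ => (ind_of_false ?_).le).trans zero_le
    rw [not_not]
    intro x _
    have h0 : uncoloredDenseNeighbors G (epsilon K (maxDeg G)) χ x = ∅ := by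
      rw [uncoloredDenseNeighbors, Finset.filter_eq_empty_iff]
      intro y _ h
      exact h.1.ne (Subsingleton.elim _ _)
    rw [h0, Finset.card_empty, Nat.cast_zero]
    have : 0 ≤ Real.log n := Real.log_natCast_nonneg n
    positivity
  have hnR : (2 : ℝ) ≤ n := by exact_mod_cast hn2
  have hlog : 1 / 2 < Real.log n := by
    have := Real.log_two_gt_d9
    have := Real.log_le_log (by norm_num) hnR
    linarith
  have hK9 : 9 ≤ K := by linarith
  have hΔ : 0 < maxDeg G := by
    rcases Nat.eq_zero_or_pos (maxDeg G) with h0 | h0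
    · rw [h0, Nat.cast_zero, mul_zero] at hKG
      have : 0 < K * Real.log n := by positivity
      linarith
    · exact h0
  have hΔR : (1 : ℝ) ≤ maxDeg G := by exact_mod_cast hΔ
  set c := (K' + 5) * Real.log n with hc
  have hc1 : 1 ≤ c := by nlinarith
  -- The hypothesis on `ε⁴Δ` enters through `c ≤ K ln n ≤ ε⁴ Δ ≤ Δ / 100`.
  have hcΔ : 100 * c ≤ maxDeg G := by
    have h1 := epsilon_pos (Δ := maxDeg G) hK9
    have h2 := epsilon_le (Δ := maxDeg G) hK9
    have h3 : epsilon K (maxDeg G) ^ 4 ≤ 1 / 100 := by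
      calc _ ≤ (1 / 100 : ℝ) ^ 4 := by gcongr
        _ ≤ _ := by norm_num
    have h4 : epsilon K (maxDeg G) ^ 4 * maxDeg G ≤ 1 / 100 * maxDeg G := by gcongr
    have h5 : c ≤ K * Real.log n := by rw [hc]; gcongr; linarith
    linarith
  have ht : ⌈√(Real.log (maxDeg G))⌉₊ ≤ n := by
    have hne : Nonempty V := Fintype.card_pos_iff.1 (by omega)
    have h1 : maxDeg G < n := G.maxDegree_lt_card_verts
    refine le_trans (Nat.ceil_le.2 ?_) h1.le
    rw [Real.sqrt_le_left (by positivity)]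
    have := Real.log_le_sub_one_of_pos (x := maxDeg G) (by linarith)
    nlinarith
  obtain ⟨i, hi, hlarge, hU⟩ := exists_stopping_step (K := K) hK9 hΔ hc1
  have hUc : c * (100 * K) ^ 2 * 2 ^ (14 * √(Real.log (maxDeg G))) =
      ((K' + 5) * (100 * K) ^ 2) * Real.log n * 2 ^ (14 * √(Real.log (maxDeg G))) := by
    rw [hc]; ring
  rw [hUc] at hU
  refine (expect_coloringAfter_dense_antitone _ _ hi).trans ?_
  refine le_trans (expect_mono fun χ _ => ind_mono (mt fun h x hx => (h.dense x hx).trans hU))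
    ((expect_coloringAfter_not_invariant_le hK9 hΔ hpal hc1 hcΔ hi hlarge).trans ?_)
  exact ENNReal.ofReal_le_ofReal (failure_le hn2 (hi.trans ht))

end Coloring

end DenseColoring

theorem mainTheorem3 :
    ∀ K' : ℝ, 0 < K' → ∃ K₀ : ℝ, 0 < K₀ ∧ ∀ K : ℝ, K₀ ≤ K →
      ∃ a b : ℝ, 0 < a ∧ 0 < b ∧
        ∀ (V : Type*) [Fintype V] (C : Type*) (G : SimpleGraph V) (pal : V → Finset C)
          (ID : V → ℕ),
          Function.Injective ID →
          (∀ x, DenseColoring.maxDeg G + 1 ≤ (pal x).card) →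
          K * Real.log (Fintype.card V) ≤
            DenseColoring.epsilon K (DenseColoring.maxDeg G) ^ 4 * DenseColoring.maxDeg G →
          ENNReal.ofReal (1 - (Fintype.card V : ℝ) ^ (-K')) ≤
            (DenseColoring.coloringAfter G pal ID K
              ⌈√(Real.log (DenseColoring.maxDeg G))⌉₊).toOuterMeasure
              {χ | ∀ x, DenseColoring.IsDense G
                  (DenseColoring.epsilon K (DenseColoring.maxDeg G)) x →
                ((DenseColoring.uncoloredDenseNeighbors G
                  (DenseColoring.epsilon K (DenseColoring.maxDeg G)) χ x).card : ℝ) ≤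
                  a * Real.log (Fintype.card V) *
                    2 ^ (b * √(Real.log (DenseColoring.maxDeg G)))} := by
  intro K' hK'
  -- `K ≥ K' + 9` provides both `K ≥ 9` for the parameter estimates and `K ≥ K' + 5` for the
  -- concentration threshold.
  refine ⟨K' + 9, by linarith, fun K hK => ⟨(K' + 5) * (100 * K) ^ 2, 14, ?_, by norm_num, ?_⟩⟩
  · have : 0 < K := by linarith
    positivity
  · intro V _ C G pal ID _ hpal hKG
    exact DenseColoring.ofReal_le_toOuterMeasure_coloringAfter hK' hK hpal hKG
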